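/- **Convergence of GoSare.** Setting. Let $N\ge 1$ and let $m_\ell,n_\ell,k_\ell$ be integers with $1\le k_\ell\le m_\ell n_\ell$ for $\ell=1,\dots,N$. Parameters $x\in\mathbb R^d$, $d=\sum_\ell m_\ell n_\ell$, are collections of weight matrices $X_\ell\in\mathbb R^{m_\ell\times n_\ell}$, with the Euclidean norm; $\nabla_\ell$ denotes the gradient with respect to $X_\ell$. Put $\underline\delta=\min_\ell \frac{k_\ell}{m_\ell n_\ell}$. Let $\mathcal D$ be a probability distribution of data $\xi$, $F(x;\xi)$ a loss that for each $x$ is $\mathcal D$-integrable and, for $\mathcal D$-almost every $\xi$, differentiable at $x$, with $\nabla F(x;\xi)$ jointly measurable, and let $f(x)=\mathbb E_{\xi\sim\mathcal D}F(x;\xi)$. Assume: 1. $\inf_x f(x)>-\infty$; 2. $f$ is differentiable and $\|\nabla f(x)-\nabla f(y)\|_2\le L\|x-y\|_2$ for all $x,y$, with $L>0$; 3. for all $x$ and $\ell$, $\mathbb E_\xi[\nabla_\ell F(x;\xi)]=\nabla_\ell f(x)$ and $\mathbb E_\xi\|\nabla_\ell F(x;\xi)-\nabla_\ell f(x)\|_F^2\le\sigma_\ell^2$,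 with $\sigma_\ell>0$. Put $\sigma=\sqrt{\sum_\ell\sigma_\ell^2}$. GoSare (small-batch stochastic gradients, momentum SGD) with parameters $\beta_1,\tau,\eta$ starts at a deterministic $x^{(0)}$ with $M_\ell^{(-1)}=0$. In iteration $t=0,1,2,\dots$ it draws $\xi^{(t)}\sim\mathcal D$ and sets $G_\ell^{(t)}=\nabla_\ell F(x^{(t)};\xi^{(t)})$; if $\tau\mid t$ it draws $S_\ell^{(t)}$ uniformly from the matrices in $\{0,1\}^{m_\ell\times n_\ell}$ with exactly $k_\ell$ ones, and otherwise $S_\ell^{(t)}=S_\ell^{(t-1)}$; then $$M_\ell^{(t)}=(1-\beta_1)S_\ell^{(t)}\odot M_\ell^{(t-1)}+\beta_1 S_\ell^{(t)}\odot G_\ell^{(t)},\qquad X_\ell^{(t+1)}=X_\ell^{(t)}-\eta\, S_\ell^{(t)}\odot M_\ell^{(t)}.$$ All draws are mutually independent. Let $\Delta=f(x^{(0)})-\inf_x f(x)$. Claims. There is a universal constant $C>0$ such that in every such setting the following holds. (a) If $$0<\beta_1\le 1,\quad \tau\ge\frac{64}{3\beta_1\underline\delta},\quad 0<\eta\le\min\left\{\frac1{4L},\sqrt{\frac{3\underline\delta\beta_1^2}{80L^2}},\sqrt{\frac{3\underline\delta}{80\tau^2L^2}},\sqrt{\frac{3\beta_1}{16\tau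 L^2}}\right\}$$ ($\tau$ an integer), then $\mathbb E\|\nabla f(x^{(t)})\|_2^2<\infty$ for all $t$, and for every $K\ge1$ $$\frac1{K\tau}\sum_{t=0}^{K\tau-1}\mathbb E\|\nabla f(x^{(t)})\|_2^2\le\frac{16\Delta}{\underline\delta\eta K\tau}+\frac{32\beta_1\sigma^2}{3\underline\delta}.$$ (b) Suppose $\Delta>0$, let $T$ be an integer with $T\ge 2+\frac{128}{3\underline\delta}+\frac{(128\sigma)^2}{9\sqrt{\underline\delta}L\Delta}$, and choose $$\beta_1=\left(1+\sqrt{\frac{\underline\delta^{3/2}\sigma^2T}{L\Delta}}\right)^{-1},\quad \tau=\left\lceil\frac{64}{3\underline\delta\beta_1}\right\rceil,\quad \eta=\left(4L+\sqrt{\frac{80L^2}{3\underline\delta\beta_1^2}}+\sqrt{\frac{80\tau^2L^2}{3\underline\delta}}+\sqrt{\frac{16\tau L^2}{3\beta_1}}\right)^{-1}.$$ Then $\mathbb E\|\nabla f(x^{(t)})\|_2^2<\infty$ for all $t$, and $$\frac1T\sum_{t=0}^{T-1}\mathbb E\|\nabla f(x^{(t)})\|_2^2\le C\left(\frac{L\Delta}{\underline\delta^{5/2}T}+\sqrt{\frac{L\Delta\sigma^2}{\underline\delta^{7/2}T}}\right).$$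 (c) Suppose $\Delta>0$. For every $\varepsilon>0$ there is an integer $T_0$ such that running GoSare for $T_0$ iterations, with the parameters of (b) for $T=T_0$, evaluates at most $$C\left(\frac{L\Delta\sigma^2}{\underline\delta^{7/2}\varepsilon^2}+\frac{L\Delta}{\underline\delta^{5/2}\varepsilon}+\frac{\sigma^2}{\underline\delta^{1/2}L\Delta}+\frac1{\underline\delta}\right)$$ stochastic gradients, and such that every integer $T\ge T_0$ satisfies the lower bound on $T$ in (b) and, with the parameters of (b) for this $T$, $\frac1T\sum_{t=0}^{T-1}\mathbb E\|\nabla f(x^{(t)})\|_2^2\le\varepsilon$; in particular $\mathbb E\|\nabla f(x^{(t)})\|_2^2\le\varepsilon$ for some $t<T$. -/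

import Mathlib

noncomputable section

namespace GoSare

open MeasureTheory ProbabilityTheory

/-- The squared Frobenius norm of a real matrix. -/
def frobSq {a b : ℕ} (A : Matrix (Fin a) (Fin b) ℝ) : ℝ :=
  ∑ i, ∑ j, A i j ^ 2

/-- The product (equivalently, Borel) `σ`-algebra on real matrices. -/
instance matrixMeasurableSpace (a b : ℕ) : MeasurableSpace (Matrix (Fin a) (Fin b) ℝ) :=
  inferInstanceAs (MeasurableSpace (Fin a → Fin b → ℝ))

/-- The set of `a × b` matrices with entries in `{0, 1}` having exactly `k` ones. -/
def sparseMasks (a b k : ℕ) : Set (Matrix (Fin a) (Fin b) ℝ) :=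
  {S | (∀ i j, S i j = 0 ∨ S i j = 1) ∧ frobSq S = k}

/-- One `m ℓ × n ℓ` real matrix for every layer `ℓ`. -/
abbrev Layers {N : ℕ} (m n : Fin N → ℕ) : Type :=
  (ℓ : Fin N) → Matrix (Fin (m ℓ)) (Fin (n ℓ)) ℝ

/-- The parameter space `ℝ^d`, `d = ∑ ℓ, m ℓ * n ℓ`, with the Euclidean norm; coordinates are
indexed by a layer and an entry of the weight matrix of that layer. -/
abbrev Params {N : ℕ} (m n : Fin N → ℕ) : Type :=
  EuclideanSpace ℝ ((ℓ : Fin N) × (Fin (m ℓ) × Fin (n ℓ)))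

section Setting

variable {N : ℕ} {m n : Fin N → ℕ} {Ξ : Type*}

/-- The weight matrix of layer `ℓ` of a parameter vector. -/
def layer (x : Params m n) (ℓ : Fin N) : Matrix (Fin (m ℓ)) (Fin (n ℓ)) ℝ :=
  Matrix.of fun i j => x ⟨ℓ, (i, j)⟩

/-- The parameter vector that collects all weight matrices. -/
def vec (X : Layers m n) : Params m n :=
  WithLp.toLp 2 fun p => X p.1 p.2.1 p.2.2

/-- `∇_ℓ g (x)`, the gradient with respect to the weight matrix of layer `ℓ`. -/
def layerGrad (g : Params m n → ℝ) (x : Params m n) (ℓ : Fin N) :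
    Matrix (Fin (m ℓ)) (Fin (n ℓ)) ℝ :=
  layer (gradient g x) ℓ

/-- The smallest density `k ℓ / (m ℓ * n ℓ)` over the layers. -/
def minDensity (m n k : Fin N → ℕ) : ℝ :=
  ⨅ ℓ, (k ℓ : ℝ) / ((m ℓ : ℝ) * (n ℓ : ℝ))

/-- The total noise level `√(∑ ℓ, σ ℓ ^ 2)`. -/
def totalNoise (σ : Fin N → ℝ) : ℝ :=
  √(∑ ℓ, σ ℓ ^ 2)

/-- The objective `f(x) = 𝔼_{ξ ∼ D} F(x; ξ)`. -/
def objective [MeasurableSpace Ξ] (F : Params m n → Ξ → ℝ) (D : Measure Ξ) (x : Params m n) : ℝ :=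
  ∫ s, F x s ∂D

/-- The initial gap `Δ = f(x₀) - inf f`. -/
def gap (f : Params m n → ℝ) (x₀ : Params m n) : ℝ :=
  f x₀ - ⨅ x, f x

/-- `f` is differentiable and its gradient is `L`-Lipschitz for the Euclidean norm. -/
structure LSmooth (f : Params m n → ℝ) (L : ℝ) : Prop where
  differentiable : Differentiable ℝ f
  lipschitz : ∀ x y, ‖gradient f x - gradient f y‖ ≤ L * ‖x - y‖

/-- `F` is a loss with a well-defined mean, and its sample gradients are well-defined
measurable random vectors. -/
structure IsLoss [MeasurableSpace Ξ] (F : Params m n → Ξ → ℝ) (D : Measure Ξ) : Prop where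
  integrable : ∀ x, Integrable (F x) D
  differentiableAt : ∀ x, ∀ᵐ s ∂D, DifferentiableAt ℝ (fun y => F y s) x
  measurable_gradient :
    Measurable fun p : Params m n × Ξ => gradient (fun y => F y p.2) p.1

/-- The stochastic gradients `∇_ℓ F(x; ξ)`, `ξ ∼ D`, are unbiased, with variance at most
`σ ℓ ^ 2` in layer `ℓ`. -/
structure StochasticGradient [MeasurableSpace Ξ] (F : Params m n → Ξ → ℝ) (D : Measure Ξ)
    (σ : Fin N → ℝ) : Prop where
  sigma_pos : ∀ ℓ, 0 < σ ℓ
  integrable : ∀ x ℓ i j, Integrable (fun s => layerGrad (fun y => F y s) x ℓ i j) D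
  unbiased : ∀ x ℓ i j,
    ∫ s, layerGrad (fun y => F y s) x ℓ i j ∂D = layerGrad (objective F D) x ℓ i j
  integrable_sq : ∀ x ℓ, Integrable
    (fun s => frobSq (layerGrad (fun y => F y s) x ℓ - layerGrad (objective F D) x ℓ)) D
  variance_le : ∀ x ℓ,
    ∫ s, frobSq (layerGrad (fun y => F y s) x ℓ - layerGrad (objective F D) x ℓ) ∂D ≤ σ ℓ ^ 2

/-- The state of the algorithm at the beginning of iteration `t`: the iterate `x^(t)`, the
momenta `M_ℓ^(t-1)`, the masks `S_ℓ^(t-1)`, and the number of stochastic gradients `∇F(x; ξ)`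
evaluated so far. -/
structure State (m n : Fin N → ℕ) where
  /-- the current iterate -/
  x : Params m n
  /-- the momentum of every layer -/
  M : Layers m n
  /-- the mask of every layer -/
  S : Layers m n
  /-- the number of stochastic gradient evaluations -/
  calls : ℕ

/-- One iteration, number `t`, of GoSare with small-batch stochastic gradients and MSGD.
`s` is the data sample of this iteration, and `newMasks` are the masks that are installed if
`t ≡ 0 (mod τ)`. -/
def step (F : Params m n → Ξ → ℝ) (β : ℝ) (τ : ℕ) (η : ℝ) (t : ℕ) (s : Ξ) (newMasks : Layers m n)
    (st : State m n) : State m n :=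
  let G : Layers m n := fun ℓ => layerGrad (fun y => F y s) st.x ℓ
  let S : Layers m n := if t % τ = 0 then newMasks else st.S
  let R : Layers m n := fun ℓ => (S ℓ).hadamard (G ℓ)
  let M : Layers m n := fun ℓ => (1 - β) • (S ℓ).hadamard (st.M ℓ) + β • R ℓ
  { x := vec fun ℓ => layer st.x ℓ - η • (S ℓ).hadamard (M ℓ)
    M := M
    S := S
    calls := st.calls + 1 }

/-- The state after `t` iterations, for given data samples `ξ t` (one per iteration) and given
mask draws `U j` (the draw `U j` is used at iteration `j * τ`). The momenta start at zero; the
initial value of the masks is irrelevant, since iteration `0` installs new masks. -/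
def run (F : Params m n → Ξ → ℝ) (β : ℝ) (τ : ℕ) (η : ℝ) (x₀ : Params m n)
    (ξ : ℕ → Ξ) (U : ℕ → Layers m n) : ℕ → State m n
  | 0 => { x := x₀, M := fun _ => 0, S := fun _ => 0, calls := 0 }
  | t + 1 => step F β τ η t (ξ t) (U (t / τ)) (run F β τ η x₀ ξ U t)

variable {Ω : Type*}

/-- The randomness of GoSare on a probability space `(Ω, μ)`: data samples `ξ t ∼ D` and masks
`U j ℓ` uniform on the `k ℓ`-sparse masks of layer `ℓ`, all of them mutually independent. -/
structure IsSampling [MeasurableSpace Ξ] [MeasurableSpace Ω] (D : Measure Ξ) (k : Fin N → ℕ)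
    (μ : Measure Ω) (ξ : ℕ → Ω → Ξ)
    (U : ℕ → (ℓ : Fin N) → Ω → Matrix (Fin (m ℓ)) (Fin (n ℓ)) ℝ) : Prop where
  measurable_data : ∀ t, Measurable (ξ t)
  measurable_mask : ∀ j ℓ, Measurable (U j ℓ)
  law_data : ∀ t, μ.map (ξ t) = D
  law_mask : ∀ j ℓ, μ.map (U j ℓ) = uniformOn (sparseMasks (m ℓ) (n ℓ) (k ℓ))
  indep : iIndep (fun i : ℕ ⊕ (ℕ × Fin N) =>
    Sum.elim (fun t => MeasurableSpace.comap (ξ t) inferInstance)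
      (fun p => MeasurableSpace.comap (U p.1 p.2) inferInstance) i) μ

/-- The random state of GoSare after `t` iterations. -/
def process (F : Params m n → Ξ → ℝ) (β : ℝ) (τ : ℕ) (η : ℝ) (x₀ : Params m n)
    (ξ : ℕ → Ω → Ξ) (U : ℕ → (ℓ : Fin N) → Ω → Matrix (Fin (m ℓ)) (Fin (n ℓ)) ℝ)
    (t : ℕ) (ω : Ω) : State m n :=
  run F β τ η x₀ (fun t' => ξ t' ω) (fun j ℓ => U j ℓ ω) t

/-- The random variable `‖∇f(x^(t))‖²`, where `x^(t)` is the iterate of GoSare. -/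
def gradSq [MeasurableSpace Ξ] (F : Params m n → Ξ → ℝ) (D : Measure Ξ)
    (x₀ : Params m n) (ξ : ℕ → Ω → Ξ)
    (U : ℕ → (ℓ : Fin N) → Ω → Matrix (Fin (m ℓ)) (Fin (n ℓ)) ℝ)
    (β : ℝ) (τ : ℕ) (η : ℝ) (t : ℕ) (ω : Ω) : ℝ :=
  ‖gradient (objective F D) (process F β τ η x₀ ξ U t ω).x‖ ^ 2

end Setting

/-- The smallest admissible number of iterations for the tuned hyperparameters
(`δ` minimal density, `σ` total noise level, `L` smoothness constant, `Δ` initial gap). -/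
def minIterations (δ σ L Δ : ℝ) : ℝ :=
  2 + 128 / (3 * δ) + (128 * σ) ^ 2 / (9 * √δ * L * Δ)

/-- The tuned momentum parameter. -/
def tunedBeta (δ σ L Δ : ℝ) (T : ℕ) : ℝ :=
  (1 + √(δ ^ (3 / 2 : ℝ) * σ ^ 2 * T / (L * Δ)))⁻¹

/-- The tuned period of mask changes. -/
def tunedTau (δ σ L Δ : ℝ) (T : ℕ) : ℕ :=
  ⌈64 / (3 * δ * tunedBeta δ σ L Δ T)⌉₊

/-- The tuned learning rate. -/
def tunedEta (δ σ L Δ : ℝ) (T : ℕ) : ℝ :=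
  (4 * L + √(80 * L ^ 2 / (3 * δ * tunedBeta δ σ L Δ T ^ 2))
    + √(80 * (tunedTau δ σ L Δ T : ℝ) ^ 2 * L ^ 2 / (3 * δ))
    + √(16 * (tunedTau δ σ L Δ T : ℝ) * L ^ 2 / (3 * tunedBeta δ σ L Δ T)))⁻¹

end GoSare

end

/-!
Let `g t = 𝔼‖∇f(x^(t))‖²`. The momentum of iteration `t` tracks the masked gradient
`S ⊙ ∇f(x^(t))`: the expected squared error contracts by a factor `1 - β` per iteration, up to the
drift `(L η)² / β * 𝔼‖M‖²` of the gradient and the sampling noise `β² σ²`; an error of order `g t`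
enters only when the mask changes, that is, once in `τ` iterations. As `τ ≥ 64 / (3 β δ)`, these
changes cost at most a fraction of `δ * ∑ g t`.

A fresh mask is independent of the iterate at which it is installed, so it keeps at least `δ * g t`
of the squared gradient norm in expectation, and `η` is so small that the gradient hardly drifts
within a period. Summing the descent inequality, in which the tracking error competes with the
masked gradient, hence bounds `δ * ∑ g t` by `Δ / η` plus the noise. The tuned `β` balances the two
terms.
-/

noncomputable section

namespace GoSare

open MeasureTheory ProbabilityTheory

section Sums

lemma sum_range_mul {M : Type*} [AddCommMonoid M] (x : ℕ → M) (K τ : ℕ) :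
    ∑ t ∈ Finset.range (K * τ), x t
      = ∑ j ∈ Finset.range K, ∑ r ∈ Finset.range τ, x (j * τ + r) := by
  induction K with
  | zero => simp
  | succ K ih => rw [Finset.sum_range_succ, ← ih, add_mul, one_mul, Finset.sum_range_add]

lemma sum_range_mul_ite_dvd {M : Type*} [AddCommMonoid M] (x : ℕ → M) (K : ℕ) {τ : ℕ}
    (hτ : 0 < τ) :
    ∑ t ∈ Finset.range (K * τ), (if τ ∣ t then x t else 0)
      = ∑ j ∈ Finset.range K, x (j * τ) := by
  rw [sum_range_mul]
  refine Finset.sum_congr rfl fun j _ => ?_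
  rw [Finset.sum_eq_single_of_mem 0 (by simpa using hτ)]
  · simp
  · intro r hr hr0
    refine if_neg fun hdvd => (Finset.mem_range.1 hr).not_ge
      (Nat.le_of_dvd (Nat.pos_of_ne_zero hr0) ?_)
    exact (Nat.dvd_add_right (Dvd.intro_left j rfl)).1 hdvd

lemma sum_range_mul_le_of_block_le {x y : ℕ → ℝ} {τ : ℕ}
    (h : ∀ j, ∀ r < τ, x (j * τ + r) ≤ y j) (K : ℕ) :
    ∑ t ∈ Finset.range (K * τ), x t ≤ τ * ∑ j ∈ Finset.range K, y j := by
  rw [sum_range_mul, Finset.mul_sum]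
  refine Finset.sum_le_sum fun j _ => ?_
  calc ∑ r ∈ Finset.range τ, x (j * τ + r) ≤ ∑ _r ∈ Finset.range τ, y j :=
        Finset.sum_le_sum fun r hr => h j r (Finset.mem_range.1 hr)
    _ = τ * y j := by simp

lemma mul_sum_mul_sum_block (q : ℕ → ℝ) (c : ℝ) (K τ : ℕ) :
    τ * ∑ j ∈ Finset.range K, c * τ * ∑ s ∈ Finset.range τ, q (j * τ + s)
      = c * τ ^ 2 * ∑ t ∈ Finset.range (K * τ), q t := by
  rw [sum_range_mul, ← Finset.mul_sum]
  ring

lemma add_mul_sum_le_of_contraction {β c v : ℝ} {e q b : ℕ → ℝ} (h0 : e 0 ≤ v + b 0)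
    (hsucc : ∀ t, e (t + 1) ≤ (1 - β) * e t + c * q t + v + b (t + 1)) (T : ℕ) :
    e T + β * ∑ t ∈ Finset.range T, e t
      ≤ c * ∑ t ∈ Finset.range T, q t + (T + 1) * v + ∑ t ∈ Finset.range (T + 1), b t := by
  induction T with
  | zero => simpa using h0
  | succ T ih =>
    rw [Finset.sum_range_succ e, Finset.sum_range_succ b (T + 1), Finset.sum_range_succ q]
    push_cast
    linarith [hsucc T]

lemma mul_sum_le_of_contraction {β c v : ℝ} {e q b : ℕ → ℝ} (hβ : β ≤ 1) (hc : 0 ≤ c)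
    (he : ∀ t, 0 ≤ e t) (hq : ∀ t, 0 ≤ q t) (h0 : e 0 ≤ v + b 0)
    (hsucc : ∀ t, e (t + 1) ≤ (1 - β) * e t + c * q t + v + b (t + 1)) (T : ℕ) :
    β * ∑ t ∈ Finset.range T, e t
      ≤ c * ∑ t ∈ Finset.range T, q t + T * v + ∑ t ∈ Finset.range T, b t := by
  cases T with
  | zero => simp
  | succ T =>
    have hsum := add_mul_sum_le_of_contraction h0 hsucc T
    have hlast : β * e T ≤ e T := mul_le_of_le_one_left (he T) hβ
    have hcq : 0 ≤ c * q T := mul_nonneg hc (hq T)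
    rw [Finset.sum_range_succ e, Finset.sum_range_succ q]
    push_cast
    linarith

lemma exists_lt_le_of_average_le {x : ℕ → ℝ} {T : ℕ} {ε : ℝ} (hT : 0 < T)
    (h : 1 / (T : ℝ) * ∑ t ∈ Finset.range T, x t ≤ ε) : ∃ t < T, x t ≤ ε := by
  have hsum : ∑ t ∈ Finset.range T, x t ≤ ∑ _t ∈ Finset.range T, ε := by
    rw [one_div, inv_mul_le_iff₀ (by positivity)] at h
    simpa using h
  simpa using Finset.exists_le_of_sum_le (Finset.nonempty_range_iff.2 hT.ne') hsum

end Sums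

section Energy

/-- The one-step estimates of masked momentum SGD in expectation, for the squared norms `a` of the
gradients, `p` of the masked gradients, `q` of the momenta and `e` of the momentum errors, and for
the objective values `φ`. Here `c` stands for `(L * η) ^ 2` and `v` for the noise variance; masks
change every `τ` steps and keep at least a fraction `δ` of the gradient. -/
structure EnergyEstimates (β δ η c v : ℝ) (τ : ℕ) (a p q e φ : ℕ → ℝ) : Prop where
  grad_nonneg : ∀ t, 0 ≤ a t
  momentum_nonneg : ∀ t, 0 ≤ q t
  error_nonneg : ∀ t, 0 ≤ e t
  error_zero : e 0 ≤ β ^ 2 * v + a 0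
  error_succ : ∀ t, e (t + 1) ≤ (1 - β) * e t + c / β * q t + β ^ 2 * v
    + if τ ∣ t + 1 then a (t + 1) else 0
  descent : ∀ t, φ (t + 1) ≤ φ t - η / 2 * p t - 3 * η / 8 * q t + η / 2 * e t
  masked_ge : ∀ j, ∀ r < τ,
    δ / 2 * a (j * τ) - c * τ * ∑ s ∈ Finset.range τ, q (j * τ + s) ≤ p (j * τ + r)
  grad_le : ∀ j, ∀ r < τ,
    a (j * τ + r) ≤ 2 * a (j * τ) + 2 * (c * τ * ∑ s ∈ Finset.range τ, q (j * τ + s))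

namespace EnergyEstimates

variable {β δ η c v : ℝ} {τ : ℕ} {a p q e φ : ℕ → ℝ}

lemma sum_error_le (h : EnergyEstimates β δ η c v τ a p q e φ) (hβ : 0 < β) (hβ1 : β ≤ 1)
    (hc : 0 ≤ c) (hτ : 0 < τ) (K : ℕ) :
    ∑ t ∈ Finset.range (K * τ), e t ≤ c / β ^ 2 * ∑ t ∈ Finset.range (K * τ), q t
      + K * τ * (β * v) + (∑ j ∈ Finset.range K, a (j * τ)) / β := by
  have hsum := mul_sum_le_of_contraction (b := fun t => if τ ∣ t then a t else 0) hβ1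
    (div_nonneg hc hβ.le) h.error_nonneg h.momentum_nonneg (by simpa using h.error_zero)
    h.error_succ (K * τ)
  rw [sum_range_mul_ite_dvd _ _ hτ, ← le_div_iff₀' hβ] at hsum
  refine hsum.trans_eq ?_
  push_cast
  field_simp

lemma sum_masked_add_sum_momentum_le (h : EnergyEstimates β δ η c v τ a p q e φ) (hη : 0 < η)
    {φinf : ℝ} (hφ : ∀ t, φinf ≤ φ t) (T : ℕ) :
    ∑ t ∈ Finset.range T, p t + 3 / 4 * ∑ t ∈ Finset.range T, q t
      ≤ 2 * (φ 0 - φinf) / η + ∑ t ∈ Finset.range T, e t := by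
  have htelescope : ∑ t ∈ Finset.range T, (η / 2 * (p t + 3 / 4 * q t - e t)) ≤ φ 0 - φ T := by
    rw [← Finset.sum_range_sub' φ T]
    exact Finset.sum_le_sum fun t _ => by linarith [h.descent t]
  rw [← Finset.mul_sum, Finset.sum_sub_distrib, Finset.sum_add_distrib, ← Finset.mul_sum]
    at htelescope
  rw [← sub_le_iff_le_add, le_div_iff₀ hη]
  linarith [hφ T]

lemma le_sum_masked (h : EnergyEstimates β δ η c v τ a p q e φ) (K : ℕ) :
    δ / 2 * (τ * ∑ j ∈ Finset.range K, a (j * τ)) - c * τ ^ 2 * ∑ t ∈ Finset.range (K * τ), q t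
      ≤ ∑ t ∈ Finset.range (K * τ), p t := by
  have hblocks := sum_range_mul_le_of_block_le (x := fun t => -p t)
    (fun j r hr => neg_le_neg (h.masked_ge j r hr)) K
  rw [Finset.sum_neg_distrib, Finset.sum_neg_distrib, Finset.sum_sub_distrib, ← Finset.mul_sum]
    at hblocks
  linarith [mul_sum_mul_sum_block q c K τ]

lemma sum_grad_le (h : EnergyEstimates β δ η c v τ a p q e φ) (K : ℕ) :
    ∑ t ∈ Finset.range (K * τ), a t ≤ 2 * (τ * ∑ j ∈ Finset.range K, a (j * τ))
      + 2 * (c * τ ^ 2 * ∑ t ∈ Finset.range (K * τ), q t) := by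
  refine (sum_range_mul_le_of_block_le h.grad_le K).trans_eq ?_
  rw [Finset.sum_add_distrib, ← Finset.mul_sum, ← Finset.mul_sum, ← mul_sum_mul_sum_block]
  ring

theorem sum_grad_le_gap_add_noise (h : EnergyEstimates β δ η c v τ a p q e φ) (hβ : 0 < β)
    (hβ1 : β ≤ 1) (hδ : 0 < δ) (hδ1 : δ ≤ 1) (hη : 0 < η) (hc : 0 ≤ c) (hv : 0 ≤ v)
    (hτ : 64 / (3 * β * δ) ≤ τ) (hcβ : c ≤ 3 * δ * β ^ 2 / 80) (hcτ : c * τ ^ 2 ≤ 3 * δ / 80)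
    {φinf : ℝ} (hφ : ∀ t, φinf ≤ φ t) (K : ℕ) :
    ∑ t ∈ Finset.range (K * τ), a t
      ≤ 16 * (φ 0 - φinf) / (δ * η) + 32 * β * v / (3 * δ) * (K * τ) := by
  have hτ0 : (0 : ℝ) < τ := lt_of_lt_of_le (by positivity) hτ
  set A := ∑ j ∈ Finset.range K, a (j * τ)
  set Q := ∑ t ∈ Finset.range (K * τ), q t
  set E := ∑ t ∈ Finset.range (K * τ), e t
  have hA : 0 ≤ A := Finset.sum_nonneg fun j _ => h.grad_nonneg _
  have hQ : 0 ≤ Q := Finset.sum_nonneg fun t _ => h.momentum_nonneg _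
  have hE : E ≤ 3 * δ / 80 * Q + K * τ * (β * v) + 3 * δ / 64 * (τ * A) := by
    refine (h.sum_error_le hβ hβ1 hc (Nat.cast_pos.1 hτ0) K).trans ?_
    have hcQ : c / β ^ 2 * Q ≤ 3 * δ / 80 * Q := by
      refine mul_le_mul_of_nonneg_right ?_ hQ
      rw [div_le_iff₀ (by positivity)]
      linarith
    have hAβ : A / β ≤ 3 * δ / 64 * (τ * A) := by
      rw [div_le_iff₀ (by positivity)] at hτ
      rw [div_le_iff₀ hβ]
      nlinarith
    linarith
  have hdrift : c * τ ^ 2 * Q ≤ 3 * δ / 80 * Q := mul_le_mul_of_nonneg_right hcτ hQ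
  have hdescent := h.sum_masked_add_sum_momentum_le hη hφ (K * τ)
  have hmasked := h.le_sum_masked K
  have hδQ : δ * Q ≤ Q := mul_le_of_le_one_left hQ hδ1
  have hδ2Q : δ * (δ * Q) ≤ δ * Q := mul_le_of_le_one_left (by positivity) hδ1
  have hδA : 0 ≤ δ * (τ * A) := by positivity
  have hnoise : 0 ≤ K * τ * (β * v) := by positivity
  calc ∑ t ∈ Finset.range (K * τ), a t ≤ 2 * (τ * A) + 2 * (3 * δ / 80 * Q) := by
        linarith [h.sum_grad_le K]
    _ ≤ 8 / δ * (2 * (φ 0 - φinf) / η + 4 / 3 * (K * τ * (β * v))) := by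
        rw [div_mul_eq_mul_div (8 : ℝ) δ, le_div_iff₀ hδ]
        linarith
    _ = 16 * (φ 0 - φinf) / (δ * η) + 32 * β * v / (3 * δ) * (K * τ) := by
        field_simp
        ring

end EnergyEstimates

end Energy

section Hyperparameters

/-- The conditions on the hyperparameters under which the energy argument closes, for minimal
density `δ` and smoothness constant `L`. They are the bounds on the learning rate of the theorem
with the square roots cleared, apart from `η ≤ √(3β / (16τL²))`, which they imply. -/
structure Admissible (δ L β : ℝ) (τ : ℕ) (η : ℝ) : Prop where
  beta_pos : 0 < β
  beta_le_one : β ≤ 1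
  le_tau : 64 / (3 * β * δ) ≤ τ
  eta_pos : 0 < η
  mul_eta_le : L * η ≤ 1 / 4
  sq_mul_eta_le : (L * η) ^ 2 ≤ 3 * δ * β ^ 2 / 80
  sq_mul_eta_mul_sq_le : (L * η) ^ 2 * (τ : ℝ) ^ 2 ≤ 3 * δ / 80

/-- The ratio of the noise term to the deterministic term in the convergence rate. -/
def noiseRatio (δ σ L Δ : ℝ) (T : ℕ) : ℝ :=
  √(δ ^ (3 / 2 : ℝ) * σ ^ 2 * T / (L * Δ))

/-- The rate of convergence of the average squared gradient norm at the tuned hyperparameters. -/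
def convergenceRate (δ σ L Δ : ℝ) (T : ℕ) : ℝ :=
  L * Δ / (δ ^ (5 / 2 : ℝ) * T) + √(L * Δ * σ ^ 2 / (δ ^ (7 / 2 : ℝ) * T))

/-- The order of the number of stochastic gradients that suffice for accuracy `ε`. -/
def gradientComplexity (δ σ L Δ ε : ℝ) : ℝ :=
  L * Δ * σ ^ 2 / (δ ^ (7 / 2 : ℝ) * ε ^ 2) + L * Δ / (δ ^ (5 / 2 : ℝ) * ε)
    + σ ^ 2 / (δ ^ (1 / 2 : ℝ) * L * Δ) + 1 / δ

/-- A number of iterations that suffices for accuracy `ε`: the last two terms make each half of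
`2600 * convergenceRate` at most `ε / 2`. -/
def sufficientIterations (δ σ L Δ ε : ℝ) : ℕ :=
  ⌈minIterations δ σ L Δ + 5200 * (L * Δ / (δ ^ (5 / 2 : ℝ) * ε))
    + 5200 ^ 2 * (L * Δ * σ ^ 2 / (δ ^ (7 / 2 : ℝ) * ε ^ 2))⌉₊

variable {δ σ L Δ : ℝ} {T : ℕ}

lemma Admissible.tau_pos {β η : ℝ} {τ : ℕ} (hadm : Admissible δ L β τ η) (hδ : 0 < δ) : 0 < τ := by
  have hβ := hadm.beta_pos
  exact Nat.cast_pos.1 ((by positivity : 0 < 64 / (3 * β * δ)).trans_le hadm.le_tau)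

lemma Admissible.of_le_sqrt {β η : ℝ} {τ : ℕ} (hδ : 0 < δ) (hL : 0 < L) (hβ : 0 < β)
    (hβ1 : β ≤ 1) (hτ : 64 / (3 * β * δ) ≤ τ) (hη : 0 < η) (hηL : η ≤ 1 / (4 * L))
    (hηβ : η ≤ √(3 * δ * β ^ 2 / (80 * L ^ 2)))
    (hητ : η ≤ √(3 * δ / (80 * (τ : ℝ) ^ 2 * L ^ 2))) : Admissible δ L β τ η := by
  have hτ0 : (0 : ℝ) < τ := lt_of_lt_of_le (by positivity) hτ
  rw [le_div_iff₀ (by positivity)] at hηL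
  rw [Real.le_sqrt' hη, le_div_iff₀ (by positivity)] at hηβ hητ
  exact ⟨hβ, hβ1, hτ, hη, by linarith, by linarith, by linarith⟩

lemma noiseRatio_nonneg : 0 ≤ noiseRatio δ σ L Δ T := Real.sqrt_nonneg _

lemma inv_tunedBeta : (tunedBeta δ σ L Δ T)⁻¹ = 1 + noiseRatio δ σ L Δ T := inv_inv _

lemma tunedBeta_pos : 0 < tunedBeta δ σ L Δ T := by
  rw [← inv_pos, inv_tunedBeta]
  linarith [noiseRatio_nonneg (δ := δ) (σ := σ) (L := L) (Δ := Δ) (T := T)]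

lemma tunedBeta_le_one : tunedBeta δ σ L Δ T ≤ 1 := by
  rw [← inv_inv (tunedBeta δ σ L Δ T), inv_tunedBeta]
  exact inv_le_one_of_one_le₀ (le_add_of_nonneg_right noiseRatio_nonneg)

lemma tunedBeta_mul_noiseRatio_le_one : tunedBeta δ σ L Δ T * noiseRatio δ σ L Δ T ≤ 1 := by
  rw [← le_div_iff₀' tunedBeta_pos, one_div, inv_tunedBeta]
  exact le_add_of_nonneg_left zero_le_one

lemma sq_noiseRatio (hδ : 0 < δ) (hL : 0 < L) (hΔ : 0 < Δ) :
    noiseRatio δ σ L Δ T ^ 2 = √δ ^ 3 * σ ^ 2 * T / (L * Δ) := by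
  rw [noiseRatio, Real.sq_sqrt (by positivity), Real.rpow_div_two_eq_sqrt _ hδ.le, Real.rpow_ofNat]

lemma le_tunedTau : 64 / (3 * tunedBeta δ σ L Δ T * δ) ≤ tunedTau δ σ L Δ T := by
  rw [mul_right_comm]
  exact Nat.le_ceil _

lemma tunedTau_le_add_one (hδ : 0 < δ) :
    (tunedTau δ σ L Δ T : ℝ) ≤ 64 / (3 * δ * tunedBeta δ σ L Δ T) + 1 :=
  (Nat.ceil_lt_add_one (by have := tunedBeta_pos (δ := δ) (σ := σ) (L := L) (Δ := Δ) (T := T)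
                           positivity)).le

lemma tunedTau_pos (hδ : 0 < δ) : (0 : ℝ) < tunedTau δ σ L Δ T := by
  have hβ := tunedBeta_pos (δ := δ) (σ := σ) (L := L) (Δ := Δ) (T := T)
  exact lt_of_lt_of_le (by positivity) le_tunedTau

lemma tunedTau_le_div (hδ : 0 < δ) (hδ1 : δ ≤ 1) :
    (tunedTau δ σ L Δ T : ℝ) ≤ 23 / (δ * tunedBeta δ σ L Δ T) := by
  have hτ := tunedTau_le_add_one (σ := σ) (L := L) (Δ := Δ) (T := T) hδ
  have hβ := tunedBeta_pos (δ := δ) (σ := σ) (L := L) (Δ := Δ) (T := T)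
  have hδβ : δ * tunedBeta δ σ L Δ T ≤ 1 := mul_le_one₀ hδ1 hβ.le tunedBeta_le_one
  refine hτ.trans ?_
  rw [le_div_iff₀ (by positivity), add_mul]
  have hcancel : 64 / (3 * δ * tunedBeta δ σ L Δ T) * (δ * tunedBeta δ σ L Δ T) = 64 / 3 := by
    field_simp
  linarith

lemma two_le_minIterations (hδ : 0 < δ) (hL : 0 < L) (hΔ : 0 < Δ) :
    2 ≤ minIterations δ σ L Δ := by
  rw [minIterations, add_assoc]
  exact le_add_of_nonneg_right (by positivity)

lemma pos_of_minIterations_le (hδ : 0 < δ) (hL : 0 < L) (hΔ : 0 < Δ)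
    (hT : minIterations δ σ L Δ ≤ T) : 0 < T := by
  rw [← Nat.cast_pos (α := ℝ)]
  linarith [two_le_minIterations (σ := σ) hδ hL hΔ]

lemma noiseRatio_le (hδ : 0 < δ) (hL : 0 < L) (hΔ : 0 < Δ)
    (hT : (128 * σ) ^ 2 / (9 * √δ * L * Δ) ≤ T) : noiseRatio δ σ L Δ T ≤ 3 * δ * T / 128 := by
  refine (sq_le_sq₀ noiseRatio_nonneg (by positivity)).1 ?_
  have hδ_sq : √δ ^ 4 = δ ^ 2 := by rw [show 4 = 2 * 2 from rfl, pow_mul, Real.sq_sqrt hδ.le]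
  have : 0 < √δ := Real.sqrt_pos.2 hδ
  calc noiseRatio δ σ L Δ T ^ 2
      = (128 * σ) ^ 2 / (9 * √δ * L * Δ) * (9 * √δ ^ 4 * T / 128 ^ 2) := by
        rw [sq_noiseRatio hδ hL hΔ]
        field_simp
    _ ≤ T * (9 * √δ ^ 4 * T / 128 ^ 2) := by gcongr
    _ = (3 * δ * T / 128) ^ 2 := by
        rw [hδ_sq]
        ring

lemma tunedTau_le (hδ : 0 < δ) (hL : 0 < L) (hΔ : 0 < Δ) (hT : minIterations δ σ L Δ ≤ T) :
    tunedTau δ σ L Δ T ≤ T := by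
  have hnoise_term : 0 ≤ (128 * σ) ^ 2 / (9 * √δ * L * Δ) := by positivity
  have hdensity_term : 0 ≤ 128 / (3 * δ) := by positivity
  have hratio : noiseRatio δ σ L Δ T ≤ 3 * δ * T / 128 :=
    noiseRatio_le hδ hL hΔ (by unfold minIterations at hT; linarith)
  have hτ := tunedTau_le_add_one (σ := σ) (L := L) (Δ := Δ) (T := T) hδ
  rw [← div_div, div_eq_mul_inv _ (tunedBeta δ σ L Δ T), inv_tunedBeta] at hτ
  have hhalf : 64 / (3 * δ) * noiseRatio δ σ L Δ T ≤ T / 2 := by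
    calc 64 / (3 * δ) * noiseRatio δ σ L Δ T ≤ 64 / (3 * δ) * (3 * δ * T / 128) := by gcongr
      _ = T / 2 := by
        field_simp
        ring
  have hsplit : 128 / (3 * δ) = 2 * (64 / (3 * δ)) := by ring
  unfold minIterations at hT
  rw [← Nat.cast_le (α := ℝ)]
  linarith

lemma tunedEta_pos (hL : 0 < L) : 0 < tunedEta δ σ L Δ T := by
  unfold tunedEta
  positivity

theorem tuned_admissible (hδ : 0 < δ) (hL : 0 < L) :
    Admissible δ L (tunedBeta δ σ L Δ T) (tunedTau δ σ L Δ T) (tunedEta δ σ L Δ T) := by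
  have hβ := tunedBeta_pos (δ := δ) (σ := σ) (L := L) (Δ := Δ) (T := T)
  have hτ := tunedTau_pos (σ := σ) (L := L) (Δ := Δ) (T := T) hδ
  have hβ_term := Real.sqrt_nonneg (80 * L ^ 2 / (3 * δ * tunedBeta δ σ L Δ T ^ 2))
  have hτ_term := Real.sqrt_nonneg (80 * (tunedTau δ σ L Δ T : ℝ) ^ 2 * L ^ 2 / (3 * δ))
  have hβτ_term := Real.sqrt_nonneg
    (16 * (tunedTau δ σ L Δ T : ℝ) * L ^ 2 / (3 * tunedBeta δ σ L Δ T))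
  refine .of_le_sqrt hδ hL hβ tunedBeta_le_one le_tunedTau (tunedEta_pos hL) ?_ ?_ ?_
  · rw [one_div]
    exact inv_anti₀ (by positivity) (by linarith)
  all_goals
    rw [← inv_div, Real.sqrt_inv]
    exact inv_anti₀ (Real.sqrt_pos.2 (by positivity)) (by linarith)

lemma sqrt_sq_mul_div_le {β τ : ℝ} (hδ : 0 < δ) (hL : 0 < L) (hβ : 0 < β) (hτ0 : 0 ≤ τ)
    (hτ : τ ≤ 23 / (δ * β)) : √(80 * τ ^ 2 * L ^ 2 / (3 * δ)) ≤ 138 * L / (√δ ^ 3 * β) := by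
  have : 0 < √δ := Real.sqrt_pos.2 hδ
  have hδs : δ = √δ ^ 2 := (Real.sq_sqrt hδ.le).symm
  refine Real.sqrt_le_iff.2 ⟨by positivity, ?_⟩
  set s := √δ
  calc 80 * τ ^ 2 * L ^ 2 / (3 * δ) ≤ 108 * (23 / (δ * β)) ^ 2 * L ^ 2 / (3 * δ) := by
        gcongr
        norm_num
    _ = (138 * L / (s ^ 3 * β)) ^ 2 := by
        rw [hδs]
        field_simp
        norm_num

lemma sqrt_mul_div_le {β τ : ℝ} (hδ : 0 < δ) (hL : 0 < L) (hβ : 0 < β)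
    (hτ : τ ≤ 23 / (δ * β)) : √(16 * τ * L ^ 2 / (3 * β)) ≤ 12 * L / (√δ * β) := by
  have : 0 < √δ := Real.sqrt_pos.2 hδ
  have hδs : δ = √δ ^ 2 := (Real.sq_sqrt hδ.le).symm
  refine Real.sqrt_le_iff.2 ⟨by positivity, ?_⟩
  set s := √δ
  calc 16 * τ * L ^ 2 / (3 * β) ≤ 16 * (27 / (δ * β)) * L ^ 2 / (3 * β) := by
        gcongr
        exact hτ.trans (by gcongr; norm_num)
    _ = (12 * L / (s * β)) ^ 2 := by
        rw [hδs]
        field_simp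
        norm_num

lemma inv_tunedEta_le (hδ : 0 < δ) (hδ1 : δ ≤ 1) (hL : 0 < L) :
    (tunedEta δ σ L Δ T)⁻¹ ≤ 160 * L / (√δ ^ 3 * tunedBeta δ σ L Δ T) := by
  have hτ0 := (tunedTau_pos (σ := σ) (L := L) (Δ := Δ) (T := T) hδ).le
  have hτ := tunedTau_le_div (σ := σ) (L := L) (Δ := Δ) (T := T) hδ hδ1
  have hβ := tunedBeta_pos (δ := δ) (σ := σ) (L := L) (Δ := Δ) (T := T)
  have hβ1 := tunedBeta_le_one (δ := δ) (σ := σ) (L := L) (Δ := Δ) (T := T)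
  rw [tunedEta, inv_inv]
  set β := tunedBeta δ σ L Δ T
  set τ := (tunedTau δ σ L Δ T : ℝ)
  have hs : 0 < √δ := Real.sqrt_pos.2 hδ
  have hs1 : √δ ≤ 1 := Real.sqrt_le_one.2 hδ1
  have hδs : δ = √δ ^ 2 := (Real.sq_sqrt hδ.le).symm
  set s := √δ
  have hβ_term : √(80 * L ^ 2 / (3 * δ * β ^ 2)) ≤ 6 * L / (s * β) := by
    refine Real.sqrt_le_iff.2 ⟨by positivity, ?_⟩
    rw [hδs, div_pow, div_le_div_iff₀ (by positivity) (by positivity)]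
    nlinarith [sq_nonneg (L * s * β)]
  have hτ_term := sqrt_sq_mul_div_le hδ hL hβ hτ0 hτ
  have hβτ_term := sqrt_mul_div_le hδ hL hβ hτ
  have hone : 1 ≤ 1 / (s ^ 3 * β) :=
    (one_le_div (by positivity)).2 (mul_le_one₀ (pow_le_one₀ hs.le hs1) hβ.le hβ1)
  have hpow : 1 / (s * β) ≤ 1 / (s ^ 3 * β) := by
    gcongr
    exact pow_le_of_le_one hs.le hs1 three_ne_zero
  calc 4 * L + _ + _ + _ ≤ 4 * L * 1 + 6 * L / (s * β) + 138 * L / (s ^ 3 * β)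
        + 12 * L / (s * β) := by
        rw [mul_one]
        gcongr
    _ = 4 * L * 1 + 18 * L * (1 / (s * β)) + 138 * L * (1 / (s ^ 3 * β)) := by ring
    _ ≤ 4 * L * (1 / (s ^ 3 * β)) + 18 * L * (1 / (s ^ 3 * β))
        + 138 * L * (1 / (s ^ 3 * β)) := by gcongr
    _ = 160 * L / (s ^ 3 * β) := by ring

lemma convergenceRate_eq (hδ : 0 < δ) (hL : 0 < L) (hΔ : 0 < Δ) (hT : 0 < T) :
    convergenceRate δ σ L Δ T = L * Δ / (√δ ^ 5 * T) * (1 + noiseRatio δ σ L Δ T) := by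
  have : 0 < √δ := Real.sqrt_pos.2 hδ
  have hr := noiseRatio_nonneg (δ := δ) (σ := σ) (L := L) (Δ := Δ) (T := T)
  have hsqrt : √(L * Δ * σ ^ 2 / (√δ ^ 7 * T)) = L * Δ / (√δ ^ 5 * T) * noiseRatio δ σ L Δ T := by
    rw [Real.sqrt_eq_iff_eq_sq (by positivity) (by positivity), mul_pow, sq_noiseRatio hδ hL hΔ]
    field_simp
  simp only [convergenceRate, Real.rpow_div_two_eq_sqrt _ hδ.le, Real.rpow_ofNat]
  rw [hsqrt, mul_add, mul_one]

lemma convergenceRate_nonneg (hδ : 0 < δ) (hL : 0 < L) (hΔ : 0 < Δ) :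
    0 ≤ convergenceRate δ σ L Δ T := by
  unfold convergenceRate
  positivity

theorem tuned_bound_le (hδ : 0 < δ) (hδ1 : δ ≤ 1) (hL : 0 < L) (hΔ : 0 < Δ) (hT : 0 < T) :
    16 * Δ / (δ * tunedEta δ σ L Δ T * T) + 64 * tunedBeta δ σ L Δ T * σ ^ 2 / (3 * δ)
      ≤ 2600 * convergenceRate δ σ L Δ T := by
  have hη := tunedEta_pos (δ := δ) (σ := σ) (Δ := Δ) (T := T) hL
  have := tunedBeta_pos (δ := δ) (σ := σ) (L := L) (Δ := Δ) (T := T)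
  have hr := noiseRatio_nonneg (δ := δ) (σ := σ) (L := L) (Δ := Δ) (T := T)
  have hβr := tunedBeta_mul_noiseRatio_le_one (δ := δ) (σ := σ) (L := L) (Δ := Δ) (T := T)
  have hs : 0 < √δ := Real.sqrt_pos.2 hδ
  have hδs : δ = √δ ^ 2 := (Real.sq_sqrt hδ.le).symm
  have hr2 := sq_noiseRatio (σ := σ) (T := T) hδ hL hΔ
  rw [convergenceRate_eq hδ hL hΔ hT]
  set r := noiseRatio δ σ L Δ T
  set rate := L * Δ / (√δ ^ 5 * T) with hrate
  have hrate0 : 0 ≤ rate := by positivity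
  have hgap : 16 * Δ / (δ * tunedEta δ σ L Δ T * T) ≤ 2560 * (rate * (1 + r)) := by
    calc 16 * Δ / (δ * tunedEta δ σ L Δ T * T)
        = 16 * Δ / (δ * T) * (tunedEta δ σ L Δ T)⁻¹ := by field_simp
      _ ≤ 16 * Δ / (δ * T) * (160 * L / (√δ ^ 3 * tunedBeta δ σ L Δ T)) := by
        gcongr
        exact inv_tunedEta_le hδ hδ1 hL
      _ = 2560 * (rate * (tunedBeta δ σ L Δ T)⁻¹) := by
        rw [hrate, hδs, Real.sqrt_sq hs.le]
        field_simp
        norm_num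
      _ = 2560 * (rate * (1 + r)) := by rw [inv_tunedBeta]
  have hnoise : 64 * tunedBeta δ σ L Δ T * σ ^ 2 / (3 * δ) ≤ 64 / 3 * (rate * (1 + r)) := by
    calc 64 * tunedBeta δ σ L Δ T * σ ^ 2 / (3 * δ)
        = 64 / 3 * (rate * (tunedBeta δ σ L Δ T * r ^ 2)) := by
          rw [hr2, hrate, hδs, Real.sqrt_sq hs.le]
          field_simp
      _ ≤ 64 / 3 * (rate * (1 + r)) := by
          gcongr
          nlinarith
  linarith [mul_nonneg hrate0 (add_nonneg zero_le_one hr)]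

variable {ε : ℝ}

lemma sufficientIterations_le (hδ : 0 < δ) (hδ1 : δ ≤ 1) (hL : 0 < L) (hΔ : 0 < Δ) (hε : 0 < ε) :
    (sufficientIterations δ σ L Δ ε : ℝ) ≤ 3 * 10 ^ 7 * gradientComplexity δ σ L Δ ε := by
  have hmin := two_le_minIterations (σ := σ) hδ hL hΔ
  refine (Nat.ceil_lt_add_one (by positivity)).le.trans ?_
  rw [gradientComplexity, minIterations, ← Real.sqrt_eq_rpow]
  have hone : 1 ≤ 1 / δ := (one_le_div hδ).2 hδ1
  have hdensity : 128 / (3 * δ) = 128 / 3 * (1 / δ) := by field_simp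
  have hnoise : (128 * σ) ^ 2 / (9 * √δ * L * Δ) = 128 ^ 2 / 9 * (σ ^ 2 / (√δ * L * Δ)) := by
    field_simp
  have hnoise0 : 0 ≤ σ ^ 2 / (√δ * L * Δ) := by positivity
  have hgap0 : 0 ≤ L * Δ / (δ ^ (5 / 2 : ℝ) * ε) := by positivity
  have hvar0 : 0 ≤ L * Δ * σ ^ 2 / (δ ^ (7 / 2 : ℝ) * ε ^ 2) := by positivity
  rw [hdensity, hnoise]
  linarith

lemma minIterations_le_of_sufficientIterations_le (hδ : 0 < δ) (hL : 0 < L) (hΔ : 0 < Δ)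
    (hε : 0 < ε) (hT : sufficientIterations δ σ L Δ ε ≤ T) : minIterations δ σ L Δ ≤ T := by
  refine le_trans ?_ (Nat.ceil_le.1 hT)
  rw [add_assoc]
  exact le_add_of_nonneg_right (by positivity)

theorem mul_convergenceRate_le (hδ : 0 < δ) (hL : 0 < L) (hΔ : 0 < Δ) (hε : 0 < ε)
    (hT : sufficientIterations δ σ L Δ ε ≤ T) : 2600 * convergenceRate δ σ L Δ T ≤ ε := by
  have hmin := two_le_minIterations (σ := σ) hδ hL hΔ
  have hT0 : (0 : ℝ) < T := Nat.cast_pos.2 (pos_of_minIterations_le hδ hL hΔ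
    (minIterations_le_of_sufficientIterations_le hδ hL hΔ hε hT))
  replace hT := Nat.ceil_le.1 hT
  have hgap0 : 0 ≤ L * Δ / (δ ^ (5 / 2 : ℝ) * ε) := by positivity
  have hvar0 : 0 ≤ L * Δ * σ ^ 2 / (δ ^ (7 / 2 : ℝ) * ε ^ 2) := by positivity
  have hgap : L * Δ / (δ ^ (5 / 2 : ℝ) * T) ≤ ε / 5200 := by
    calc L * Δ / (δ ^ (5 / 2 : ℝ) * T)
        = ε / 5200 * (5200 * (L * Δ / (δ ^ (5 / 2 : ℝ) * ε))) / T := by field_simp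
      _ ≤ ε / 5200 * T / T := by
          gcongr
          linarith
      _ = ε / 5200 := by field_simp
  have hnoise : √(L * Δ * σ ^ 2 / (δ ^ (7 / 2 : ℝ) * T)) ≤ ε / 5200 := by
    refine Real.sqrt_le_iff.2 ⟨by positivity, ?_⟩
    calc L * Δ * σ ^ 2 / (δ ^ (7 / 2 : ℝ) * T)
        = (ε / 5200) ^ 2 * (5200 ^ 2 * (L * Δ * σ ^ 2 / (δ ^ (7 / 2 : ℝ) * ε ^ 2))) / T := by
          field_simp
      _ ≤ (ε / 5200) ^ 2 * T / T := by
          gcongr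
          linarith
      _ = (ε / 5200) ^ 2 := by field_simp
  rw [convergenceRate]
  linarith

end Hyperparameters

section Masks

variable {ι : Type*}

/-- All entries of `s` are `0` or `1`. -/
def IsMask (s : ι → ℝ) : Prop := ∀ i, s i = 0 ∨ s i = 1

lemma measurableSet_isMask [Countable ι] : MeasurableSet {s : ι → ℝ | IsMask s} := by
  rw [show {s : ι → ℝ | IsMask s} = Set.univ.pi fun _ => {0, 1} by ext s; simp [IsMask]]
  exact MeasurableSet.univ_pi fun _ => Set.Finite.measurableSet (Set.toFinite _)

variable [Fintype ι]

/-- Entrywise multiplication `s ⊙ v` of a vector by a mask, as a continuous linear map in `v`. -/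
def maskMul (s : ι → ℝ) : EuclideanSpace ℝ ι →L[ℝ] EuclideanSpace ℝ ι :=
  LinearMap.toContinuousLinearMap
    { toFun := fun v => WithLp.toLp 2 fun i => s i * v i
      map_add' := fun v w => by ext i; simp [mul_add]
      map_smul' := fun c v => by ext i; simp [mul_left_comm] }

@[simp] lemma maskMul_apply (s : ι → ℝ) (v : EuclideanSpace ℝ ι) (i : ι) :
    maskMul s v i = s i * v i := rfl

lemma measurable_maskMul :
    Measurable fun p : (ι → ℝ) × EuclideanSpace ℝ ι => maskMul p.1 p.2 := by
  change Measurable fun p : (ι → ℝ) × EuclideanSpace ℝ ι =>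
    WithLp.toLp 2 fun i => p.1 i * p.2 i
  fun_prop

lemma inner_maskMul_left (s : ι → ℝ) (v w : EuclideanSpace ℝ ι) :
    inner ℝ (maskMul s v) w = inner ℝ v (maskMul s w) := by
  simp only [PiLp.inner_apply, maskMul_apply, RCLike.inner_apply, conj_trivial]
  exact Finset.sum_congr rfl fun i _ => by ring

namespace IsMask

variable {s : ι → ℝ} (hs : IsMask s)
include hs

lemma maskMul_maskMul (v : EuclideanSpace ℝ ι) : maskMul s (maskMul s v) = maskMul s v := by
  ext i
  rcases hs i with h | h <;> simp [h]

lemma norm_sq_maskMul (v : EuclideanSpace ℝ ι) : ‖maskMul s v‖ ^ 2 = ∑ i, s i * v i ^ 2 := by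
  rw [EuclideanSpace.real_norm_sq_eq]
  refine Finset.sum_congr rfl fun i _ => ?_
  rcases hs i with h | h <;> simp [h]

lemma norm_sq_maskMul_le (v : EuclideanSpace ℝ ι) : ‖maskMul s v‖ ^ 2 ≤ ‖v‖ ^ 2 := by
  rw [hs.norm_sq_maskMul, EuclideanSpace.real_norm_sq_eq]
  refine Finset.sum_le_sum fun i _ => ?_
  rcases hs i with h | h <;> simp [h, sq_nonneg]

lemma norm_maskMul_le (v : EuclideanSpace ℝ ι) : ‖maskMul s v‖ ≤ ‖v‖ :=
  le_of_sq_le_sq (hs.norm_sq_maskMul_le v) (norm_nonneg v)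

lemma norm_sq_sub_le_of_maskMul_eq {v w : EuclideanSpace ℝ ι} (hw : maskMul s w = w) :
    ‖v - w‖ ^ 2 ≤ ‖maskMul s v - w‖ ^ 2 + ‖v‖ ^ 2 := by
  rw [← hw]
  simp only [EuclideanSpace.real_norm_sq_eq, ← Finset.sum_add_distrib]
  refine Finset.sum_le_sum fun i _ => ?_
  rcases hs i with h | h <;> simp [h, sq_nonneg]

end IsMask

end Masks

section NormInequalities

variable {E : Type*} [NormedAddCommGroup E] {β : ℝ}

lemma norm_add_sq_le_weighted (hβ : 0 < β) (a b : E) :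
    ‖a + b‖ ^ 2 ≤ (1 + β) * ‖a‖ ^ 2 + (1 + 1 / β) * ‖b‖ ^ 2 := by
  have young : 2 * ‖a‖ * ‖b‖ ≤ β * ‖a‖ ^ 2 + 1 / β * ‖b‖ ^ 2 := by
    have hsq : 0 ≤ (β * ‖a‖ - ‖b‖) ^ 2 / β := by positivity
    have hexpand : (β * ‖a‖ - ‖b‖) ^ 2 / β
        = β * ‖a‖ ^ 2 + 1 / β * ‖b‖ ^ 2 - 2 * ‖a‖ * ‖b‖ := by
      field_simp; ring
    linarith
  calc ‖a + b‖ ^ 2 ≤ (‖a‖ + ‖b‖) ^ 2 := by gcongr; exact norm_add_le a b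
    _ = ‖a‖ ^ 2 + 2 * ‖a‖ * ‖b‖ + ‖b‖ ^ 2 := by ring
    _ ≤ _ := by linarith

lemma one_sub_sq_mul_norm_add_sq_le (hβ : 0 < β) (hβ1 : β ≤ 1) (a b : E) :
    (1 - β) ^ 2 * ‖a + b‖ ^ 2 ≤ (1 - β) * ‖a‖ ^ 2 + 1 / β * ‖b‖ ^ 2 := by
  have hweight : (1 - β) ^ 2 * (1 + β) ≤ 1 - β := by
    nlinarith [mul_nonneg (sub_nonneg.2 hβ1) (sq_nonneg β)]
  have hweight_inv : (1 - β) ^ 2 * (1 + 1 / β) ≤ 1 / β :=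
    calc (1 - β) ^ 2 * (1 + 1 / β) = (1 - β) ^ 2 * (1 + β) * (1 / β) := by field_simp; ring
      _ ≤ 1 / β := mul_le_of_le_one_left (by positivity) (by linarith)
  calc (1 - β) ^ 2 * ‖a + b‖ ^ 2
      ≤ (1 - β) ^ 2 * ((1 + β) * ‖a‖ ^ 2 + (1 + 1 / β) * ‖b‖ ^ 2) := by
        gcongr; exact norm_add_sq_le_weighted hβ a b
    _ = (1 - β) ^ 2 * (1 + β) * ‖a‖ ^ 2 + (1 - β) ^ 2 * (1 + 1 / β) * ‖b‖ ^ 2 := by ring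
    _ ≤ _ := by gcongr

lemma norm_sq_le_two_mul_add (a b : E) : ‖a‖ ^ 2 ≤ 2 * ‖b‖ ^ 2 + 2 * ‖a - b‖ ^ 2 := by
  have h := norm_add_sq_le_weighted one_pos b (a - b)
  rw [add_sub_cancel] at h
  linarith

lemma norm_sq_sub_le_of_sub_smul [NormedSpace ℝ E] {η : ℝ} {x M : ℕ → E} {τ r : ℕ}
    (hx : ∀ t, x (t + 1) = x t - η • M t) (hr : r ≤ τ) :
    ‖x r - x 0‖ ^ 2 ≤ η ^ 2 * τ * ∑ t ∈ Finset.range τ, ‖M t‖ ^ 2 := by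
  have hsum : x r - x 0 = -(η • ∑ t ∈ Finset.range r, M t) := by
    rw [← Finset.sum_range_sub, Finset.smul_sum, ← Finset.sum_neg_distrib]
    exact Finset.sum_congr rfl fun t _ => by rw [hx]; abel
  rw [hsum, norm_neg, norm_smul, mul_pow, Real.norm_eq_abs, sq_abs, mul_assoc]
  gcongr
  calc ‖∑ t ∈ Finset.range r, M t‖ ^ 2 ≤ (∑ t ∈ Finset.range τ, ‖M t‖) ^ 2 := by
        gcongr
        exact (norm_sum_le _ _).trans (Finset.sum_le_sum_of_subset_of_nonneg
          (Finset.range_mono hr) fun _ _ _ => norm_nonneg _)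
    _ ≤ τ * ∑ t ∈ Finset.range τ, ‖M t‖ ^ 2 := by
        simpa using sq_sum_le_card_mul_sum_sq (s := Finset.range τ) (f := fun t => ‖M t‖)

end NormInequalities

section Pathwise

variable {ι : Type*} [Fintype ι] {β η L κ : ℝ} {s r : ι → ℝ} {g h M : EuclideanSpace ℝ ι}

lemma IsMask.momentum_error_le (hs : IsMask s) (hβ : 0 < β) (hβ1 : β ≤ 1)
    (hM : maskMul s M = M) (hgh : ‖h - g‖ ≤ κ * ‖M‖) :
    (1 - β) ^ 2 * ‖maskMul s (h - M)‖ ^ 2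
      ≤ (1 - β) * ‖maskMul s g - M‖ ^ 2 + κ ^ 2 / β * ‖M‖ ^ 2 := by
  have hsplit : maskMul s (h - M) = (maskMul s g - M) + maskMul s (h - g) := by
    rw [map_sub, map_sub, hM]; abel
  calc (1 - β) ^ 2 * ‖maskMul s (h - M)‖ ^ 2
      ≤ (1 - β) * ‖maskMul s g - M‖ ^ 2 + 1 / β * ‖maskMul s (h - g)‖ ^ 2 := by
        rw [hsplit]; exact one_sub_sq_mul_norm_add_sq_le hβ hβ1 _ _
    _ ≤ (1 - β) * ‖maskMul s g - M‖ ^ 2 + 1 / β * (κ * ‖M‖) ^ 2 := by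
        gcongr; exact (hs.norm_maskMul_le _).trans hgh
    _ = _ := by ring

/- The old momentum lives on the support of `s`, so outside of `s` the new mask `r` sees only the
gradient `h`. -/
lemma IsMask.momentum_error_le_of_mask_change (hs : IsMask s) (hr : IsMask r) (hβ : 0 < β)
    (hβ1 : β ≤ 1) (hM : maskMul s M = M) (hgh : ‖h - g‖ ≤ κ * ‖M‖) :
    (1 - β) ^ 2 * ‖maskMul r (h - M)‖ ^ 2
      ≤ (1 - β) * ‖maskMul s g - M‖ ^ 2 + κ ^ 2 / β * ‖M‖ ^ 2 + ‖h‖ ^ 2 := by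
  have hchange : ‖maskMul r (h - M)‖ ^ 2 ≤ ‖maskMul s (h - M)‖ ^ 2 + ‖h‖ ^ 2 := by
    refine (hr.norm_sq_maskMul_le _).trans ?_
    rw [map_sub, hM]
    exact hs.norm_sq_sub_le_of_maskMul_eq hM
  calc (1 - β) ^ 2 * ‖maskMul r (h - M)‖ ^ 2
      ≤ (1 - β) ^ 2 * (‖maskMul s (h - M)‖ ^ 2 + ‖h‖ ^ 2) := by gcongr
    _ = (1 - β) ^ 2 * ‖maskMul s (h - M)‖ ^ 2 + (1 - β) ^ 2 * ‖h‖ ^ 2 := mul_add _ _ _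
    _ ≤ _ := add_le_add (hs.momentum_error_le hβ hβ1 hM hgh)
        (mul_le_of_le_one_left (sq_nonneg _) (pow_le_one₀ (by linarith) (by linarith)))

/- Polarization: `2⟪s ⊙ g, M⟫ = ‖s ⊙ g‖² + ‖M‖² - ‖s ⊙ g - M‖²`. -/
lemma quadratic_eq_of_maskMul_eq (hM : maskMul s M = M) :
    inner ℝ g (-(η • M)) + L / 2 * ‖-(η • M)‖ ^ 2
      = -(η / 2) * ‖maskMul s g‖ ^ 2 - η / 2 * (1 - L * η) * ‖M‖ ^ 2
        + η / 2 * ‖maskMul s g - M‖ ^ 2 := by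
  have hinner : inner ℝ g M = inner ℝ (maskMul s g) M := by rw [inner_maskMul_left, hM]
  rw [norm_sub_sq_real, ← hinner, inner_neg_right, inner_smul_right, norm_neg, norm_smul, mul_pow,
    Real.norm_eq_abs, sq_abs]
  ring

end Pathwise

section Smooth

variable {E : Type*} [NormedAddCommGroup E] [InnerProductSpace ℝ E] [CompleteSpace E]
  {f : E → ℝ} {L : ℝ}

lemma continuous_gradient_of_lipschitz
    (hlip : ∀ x y, ‖gradient f x - gradient f y‖ ≤ L * ‖x - y‖) : Continuous (gradient f) :=
  (LipschitzWith.of_dist_le' (K := L) fun x y => by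
    simpa only [dist_eq_norm] using hlip x y).continuous

lemma le_quadratic_of_lipschitz_gradient (hf : Differentiable ℝ f)
    (hlip : ∀ x y, ‖gradient f x - gradient f y‖ ≤ L * ‖x - y‖) (x v : E) :
    f (x + v) ≤ f x + inner ℝ (gradient f x) v + L / 2 * ‖v‖ ^ 2 := by
  have hline (s : ℝ) : HasDerivAt (fun s : ℝ => x + s • v) v s := by
    simpa using ((hasDerivAt_id s).smul_const v).const_add x
  have hfline (s : ℝ) :
      HasDerivAt (fun s : ℝ => f (x + s • v)) (inner ℝ (gradient f (x + s • v)) v) s := by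
    simpa [Function.comp_def] using
      (hf (x + s • v)).hasGradientAt.hasFDerivAt.comp_hasDerivAt s (hline s)
  have hquad (s : ℝ) : HasDerivAt
      (fun s : ℝ => f x + s * inner ℝ (gradient f x) v + L / 2 * s ^ 2 * ‖v‖ ^ 2)
      (inner ℝ (gradient f x) v + L * s * ‖v‖ ^ 2) s := by
    have hlin := ((hasDerivAt_id s).mul_const (inner ℝ (gradient f x) v)).const_add (f x)
    have hsq := ((hasDerivAt_pow 2 s).const_mul (L / 2)).mul_const (‖v‖ ^ 2)
    exact (hlin.add hsq).congr_deriv (by push_cast; ring)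
  have hderiv_le (s : ℝ) (hs : 0 ≤ s) : inner ℝ (gradient f (x + s • v)) v
      ≤ inner ℝ (gradient f x) v + L * s * ‖v‖ ^ 2 := by
    rw [← sub_le_iff_le_add', ← inner_sub_left]
    calc inner ℝ (gradient f (x + s • v) - gradient f x) v
        ≤ ‖gradient f (x + s • v) - gradient f x‖ * ‖v‖ := real_inner_le_norm _ _
      _ ≤ L * ‖x + s • v - x‖ * ‖v‖ := by gcongr; exact hlip _ _
      _ = L * s * ‖v‖ ^ 2 := by
        rw [add_sub_cancel_left, norm_smul, Real.norm_of_nonneg hs]; ring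
  have hle := image_le_of_deriv_right_le_deriv_boundary (a := 0) (b := 1)
    (fun s _ => (hfline s).continuousAt.continuousWithinAt)
    (fun s _ => (hfline s).hasDerivWithinAt) (by simp)
    (fun s _ => (hquad s).continuousAt.continuousWithinAt)
    (fun s _ => (hquad s).hasDerivWithinAt) (fun s hs => hderiv_le s hs.1)
    (Set.right_mem_Icc.2 zero_le_one)
  simpa using hle

lemma abs_le_of_lipschitz_gradient (hf : Differentiable ℝ f)
    (hlip : ∀ x y, ‖gradient f x - gradient f y‖ ≤ L * ‖x - y‖) {c : ℝ} (hc : ∀ x, c ≤ f x)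
    (x v : E) :
    |f (x + v)| ≤ |f x| + |c| + ‖gradient f x‖ * ‖v‖ + |L| / 2 * ‖v‖ ^ 2 := by
  have hlin : 0 ≤ ‖gradient f x‖ * ‖v‖ := by positivity
  have hsq : 0 ≤ |L| / 2 * ‖v‖ ^ 2 := by positivity
  have hupper : f (x + v) ≤ f x + ‖gradient f x‖ * ‖v‖ + |L| / 2 * ‖v‖ ^ 2 :=
    (le_quadratic_of_lipschitz_gradient hf hlip x v).trans (by
      gcongr
      · exact real_inner_le_norm _ _
      · exact le_abs_self L)
  rw [abs_le]
  constructor <;> linarith [hc (x + v), neg_abs_le c, abs_nonneg c, le_abs_self (f x),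
    abs_nonneg (f x)]

end Smooth

section Noise

variable {Ξ E G : Type*} [MeasurableSpace Ξ] {D : Measure Ξ}
  [NormedAddCommGroup E] [InnerProductSpace ℝ E] [NormedAddCommGroup G] [InnerProductSpace ℝ G]
  {Z : Ξ → E} {v : ℝ}

/-- `Z` is a square-integrable random vector with mean zero and variance at most `v`: the noise of
an unbiased stochastic gradient. -/
structure IsCenteredNoise (D : Measure Ξ) (Z : Ξ → E) (v : ℝ) : Prop where
  memLp : MemLp Z 2 D
  integral_eq_zero : ∫ s, Z s ∂D = 0
  integral_norm_sq_le : ∫ s, ‖Z s‖ ^ 2 ∂D ≤ v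

namespace IsCenteredNoise

lemma integrable_norm_sq (hZ : IsCenteredNoise D Z v) : Integrable (fun s => ‖Z s‖ ^ 2) D :=
  hZ.memLp.integrable_norm_pow two_ne_zero

lemma nonneg (hZ : IsCenteredNoise D Z v) : 0 ≤ v :=
  (integral_nonneg fun _ => sq_nonneg _).trans hZ.integral_norm_sq_le

variable [CompleteSpace E]

lemma clm_comp [CompleteSpace G] [IsFiniteMeasure D] (hZ : IsCenteredNoise D Z v)
    (P : E →L[ℝ] G) {c : ℝ} (hP : ∀ w, ‖P w‖ ≤ c * ‖w‖) :
    IsCenteredNoise D (fun s => P (Z s)) (c ^ 2 * v) where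
  memLp := P.comp_memLp' hZ.memLp
  integral_eq_zero := by
    rw [P.integral_comp_comm (hZ.memLp.integrable one_le_two), hZ.integral_eq_zero, map_zero]
  integral_norm_sq_le :=
    calc ∫ s, ‖P (Z s)‖ ^ 2 ∂D ≤ ∫ s, c ^ 2 * ‖Z s‖ ^ 2 ∂D := by
          refine integral_mono ((P.comp_memLp' hZ.memLp).integrable_norm_pow two_ne_zero)
            (hZ.integrable_norm_sq.const_mul _) fun s => ?_
          simpa only [mul_pow] using pow_le_pow_left₀ (norm_nonneg _) (hP (Z s)) 2
      _ ≤ c ^ 2 * v := by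
          rw [integral_const_mul]
          exact mul_le_mul_of_nonneg_left hZ.integral_norm_sq_le (sq_nonneg c)

lemma integral_norm_add_sq_le [IsProbabilityMeasure D] (hZ : IsCenteredNoise D Z v) (a : E) :
    ∫ s, ‖a + Z s‖ ^ 2 ∂D ≤ ‖a‖ ^ 2 + v := by
  have hZ1 : Integrable Z D := hZ.memLp.integrable one_le_two
  have hcross : Integrable (fun s => 2 * inner ℝ a (Z s)) D := (hZ1.const_inner a).const_mul 2
  have hcross_zero : ∫ s, 2 * inner ℝ a (Z s) ∂D = 0 := by
    rw [integral_const_mul, integral_inner hZ1, hZ.integral_eq_zero, inner_zero_right, mul_zero]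
  have hlin : Integrable (fun s => ‖a‖ ^ 2 + 2 * inner ℝ a (Z s)) D :=
    (integrable_const _).add hcross
  simp only [norm_add_sq_real]
  rw [integral_add hlin hZ.integrable_norm_sq,
    integral_add (integrable_const _) hcross, hcross_zero]
  simpa using hZ.integral_norm_sq_le

end IsCenteredNoise

theorem integrable_and_integral_norm_sq_add_noise_le {Ω 𝓨 : Type*} [MeasurableSpace Ω]
    [MeasurableSpace 𝓨] [CompleteSpace E] [MeasurableSpace E] [BorelSpace E]
    [SecondCountableTopology E]
    {μ : Measure Ω} [IsProbabilityMeasure μ] {Y : Ω → 𝓨} {ζ : Ω → Ξ} {A : 𝓨 → E} {Z : 𝓨 → Ξ → E}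
    (hY : Measurable Y) (hζ : Measurable ζ) (hind : IndepFun Y ζ μ) (hA : Measurable A)
    (hZ : Measurable fun p : 𝓨 × Ξ => Z p.1 p.2)
    (hA2 : Integrable (fun ω => ‖A (Y ω)‖ ^ 2) μ)
    (hnoise : ∀ᵐ y ∂(μ.map Y), IsCenteredNoise (μ.map ζ) (Z y) v) :
    Integrable (fun ω => ‖A (Y ω) + Z (Y ω) (ζ ω)‖ ^ 2) μ ∧
      ∫ ω, ‖A (Y ω) + Z (Y ω) (ζ ω)‖ ^ 2 ∂μ ≤ ∫ ω, ‖A (Y ω)‖ ^ 2 ∂μ + v := by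
  have := Measure.isProbabilityMeasure_map hY.aemeasurable (μ := μ)
  have := Measure.isProbabilityMeasure_map hζ.aemeasurable (μ := μ)
  let H : 𝓨 × Ξ → ℝ := fun p => ‖A p.1 + Z p.1 p.2‖ ^ 2
  have hH : Measurable H := ((hA.comp measurable_fst).add hZ).norm.pow_const 2
  have hbound : Integrable (fun y => ‖A y‖ ^ 2 + v) (μ.map Y) :=
    ((integrable_map_measure (g := fun y => ‖A y‖ ^ 2) (by fun_prop) hY.aemeasurable).2 hA2).add
      (integrable_const v)
  have hinner : ∀ᵐ y ∂(μ.map Y), ∫ z, H (y, z) ∂(μ.map ζ) ≤ ‖A y‖ ^ 2 + v :=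
    hnoise.mono fun y hy => hy.integral_norm_add_sq_le (A y)
  have hHint : Integrable H ((μ.map Y).prod (μ.map ζ)) := by
    refine (integrable_prod_iff hH.aestronglyMeasurable).2 ⟨?_, ?_⟩
    · filter_upwards [hnoise] with y hy
      exact ((memLp_const (A y)).add hy.memLp).integrable_norm_pow two_ne_zero
    · refine hbound.mono' hH.stronglyMeasurable.norm.integral_prod_right'.aestronglyMeasurable ?_
      filter_upwards [hinner] with y hy
      rw [Real.norm_of_nonneg (integral_nonneg fun _ => norm_nonneg _)]
      simpa only [H, Real.norm_of_nonneg (sq_nonneg _)] using hy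
  have hlaw := (indepFun_iff_map_prod_eq_prod_map_map hY.aemeasurable hζ.aemeasurable).1 hind
  have hYζ := (hY.prodMk hζ).aemeasurable (μ := μ)
  refine ⟨(integrable_map_measure hH.aestronglyMeasurable hYζ).1 (hlaw ▸ hHint), ?_⟩
  calc ∫ ω, H (Y ω, ζ ω) ∂μ = ∫ y, ∫ z, H (y, z) ∂(μ.map ζ) ∂(μ.map Y) := by
        rw [← integral_prod _ hHint, ← hlaw, integral_map hYζ hH.aestronglyMeasurable]
    _ ≤ ∫ y, (‖A y‖ ^ 2 + v) ∂(μ.map Y) := integral_mono_ae hHint.integral_prod_left hbound hinner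
    _ = ∫ ω, (‖A (Y ω)‖ ^ 2 + v) ∂μ := integral_map hY.aemeasurable (by fun_prop)
    _ = ∫ ω, ‖A (Y ω)‖ ^ 2 ∂μ + v := by
        rw [integral_add hA2 (integrable_const v)]; simp

end Noise

section MaskedMSGD

variable {ι Ξ Ω : Type*} [Fintype ι] [MeasurableSpace Ξ] [MeasurableSpace Ω]

/-- Momentum SGD on `f` with stochastic gradients `γ`, in which period `j` of length `τ` uses the
random mask `u j`, abstracted from the layer structure and the law of the masks: only unbiasedness
and variance at most `v` of `γ`, a mean of at least `δ` for every mask entry, and the independence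
of each draw from the past are kept. `X t` is the iterate and `M t` the momentum at the beginning
of iteration `t`. -/
structure IsMaskedMSGD (D : Measure Ξ) (μ : Measure Ω) (f : EuclideanSpace ℝ ι → ℝ)
    (γ : EuclideanSpace ℝ ι → Ξ → EuclideanSpace ℝ ι) (L v δ β η : ℝ) (τ : ℕ)
    (x₀ : EuclideanSpace ℝ ι) (ξ : ℕ → Ω → Ξ) (u : ℕ → Ω → ι → ℝ)
    (X M : ℕ → Ω → EuclideanSpace ℝ ι) : Prop where
  differentiable : Differentiable ℝ f
  lipschitz : ∀ x y, ‖gradient f x - gradient f y‖ ≤ L * ‖x - y‖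
  bddBelow : BddBelow (Set.range f)
  measurable_γ : Measurable fun p : EuclideanSpace ℝ ι × Ξ => γ p.1 p.2
  noise : ∀ x, IsCenteredNoise D (fun s => γ x s - gradient f x) v
  measurable_ξ : ∀ t, Measurable (ξ t)
  measurable_u : ∀ j, Measurable (u j)
  measurable_X : ∀ t, Measurable (X t)
  measurable_M : ∀ t, Measurable (M t)
  law_ξ : ∀ t, μ.map (ξ t) = D
  isMask : ∀ j, ∀ᵐ ω ∂μ, IsMask (u j ω)
  le_mask_mean : ∀ j i, δ ≤ ∫ ω, u j ω i ∂μ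
  X_zero : ∀ ω, X 0 ω = x₀
  M_zero : ∀ ω, M 0 ω = 0
  M_succ : ∀ t ω,
    M (t + 1) ω = maskMul (u (t / τ) ω) ((1 - β) • M t ω + β • γ (X t ω) (ξ t ω))
  X_succ : ∀ t ω, X (t + 1) ω = X t ω - η • maskMul (u (t / τ) ω) (M (t + 1) ω)
  indep_ξ : ∀ t, IndepFun (fun ω => (X t ω, M t ω, u (t / τ) ω)) (ξ t) μ
  indep_u : ∀ j i, IndepFun (X (j * τ)) (fun ω => u j ω i) μ

/-- The gradient `∇f(X t)`, restricted to the mask that is active in iteration `t`. -/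
def maskedGradient (f : EuclideanSpace ℝ ι → ℝ) (τ : ℕ) (u : ℕ → Ω → ι → ℝ)
    (X : ℕ → Ω → EuclideanSpace ℝ ι) (t : ℕ) (ω : Ω) : EuclideanSpace ℝ ι :=
  maskMul (u (t / τ) ω) (gradient f (X t ω))

/-- The error of the momentum computed in iteration `t`, as an estimate of the masked gradient. -/
def momentumError (f : EuclideanSpace ℝ ι → ℝ) (τ : ℕ) (u : ℕ → Ω → ι → ℝ)
    (X M : ℕ → Ω → EuclideanSpace ℝ ι) (t : ℕ) (ω : Ω) : EuclideanSpace ℝ ι :=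
  maskedGradient f τ u X t ω - M (t + 1) ω

namespace IsMaskedMSGD

variable {D : Measure Ξ} {μ : Measure Ω} {f : EuclideanSpace ℝ ι → ℝ}
  {γ : EuclideanSpace ℝ ι → Ξ → EuclideanSpace ℝ ι} {L v δ β η : ℝ} {τ : ℕ}
  {x₀ : EuclideanSpace ℝ ι} {ξ : ℕ → Ω → Ξ} {u : ℕ → Ω → ι → ℝ}
  {X M : ℕ → Ω → EuclideanSpace ℝ ι} (h : IsMaskedMSGD D μ f γ L v δ β η τ x₀ ξ u X M)
include h

lemma measurable_gradient : Measurable (gradient f) :=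
  (continuous_gradient_of_lipschitz h.lipschitz).measurable

lemma measurable_gradient_X (t : ℕ) : Measurable fun ω => gradient f (X t ω) :=
  h.measurable_gradient.comp (h.measurable_X t)

lemma measurable_maskMul_comp (j : ℕ) {A : Ω → EuclideanSpace ℝ ι} (hA : Measurable A) :
    Measurable fun ω => maskMul (u j ω) (A ω) :=
  measurable_maskMul.comp ((h.measurable_u j).prodMk hA)

lemma iInf_le (x : EuclideanSpace ℝ ι) : ⨅ y, f y ≤ f x := ciInf_le h.bddBelow x

lemma maskMul_M_succ (t : ℕ) :
    ∀ᵐ ω ∂μ, maskMul (u (t / τ) ω) (M (t + 1) ω) = M (t + 1) ω := by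
  filter_upwards [h.isMask (t / τ)] with ω hω
  rw [h.M_succ, hω.maskMul_maskMul]

lemma X_succ_ae (t : ℕ) : ∀ᵐ ω ∂μ, X (t + 1) ω = X t ω - η • M (t + 1) ω := by
  filter_upwards [h.maskMul_M_succ t] with ω hω
  rw [h.X_succ, hω]

lemma norm_gradient_sub_le (hη : 0 ≤ η) (t : ℕ) :
    ∀ᵐ ω ∂μ, ‖gradient f (X (t + 1) ω) - gradient f (X t ω)‖ ≤ L * η * ‖M (t + 1) ω‖ := by
  filter_upwards [h.X_succ_ae t] with ω hω
  refine (h.lipschitz _ _).trans_eq ?_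
  rw [hω, sub_sub_cancel_left, norm_neg, norm_smul, Real.norm_of_nonneg hη, mul_assoc]

lemma norm_sq_gradient_drift_le (j : ℕ) {r : ℕ} (hr : r < τ) :
    ∀ᵐ ω ∂μ, ‖gradient f (X (j * τ + r) ω) - gradient f (X (j * τ) ω)‖ ^ 2
      ≤ (L * η) ^ 2 * τ * ∑ s ∈ Finset.range τ, ‖M (j * τ + s + 1) ω‖ ^ 2 := by
  filter_upwards [ae_all_iff.2 h.X_succ_ae] with ω hω
  have hdrift := norm_sq_sub_le_of_sub_smul (x := fun t => X (j * τ + t) ω)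
    (M := fun t => M (j * τ + t + 1) ω) (fun t => hω (j * τ + t)) hr.le
  calc _ ≤ (L * ‖X (j * τ + r) ω - X (j * τ) ω‖) ^ 2 := by gcongr; exact h.lipschitz _ _
    _ = L ^ 2 * ‖X (j * τ + r) ω - X (j * τ) ω‖ ^ 2 := mul_pow _ _ _
    _ ≤ L ^ 2 * (η ^ 2 * τ * ∑ s ∈ Finset.range τ, ‖M (j * τ + s + 1) ω‖ ^ 2) := by
        gcongr; exact hdrift
    _ = _ := by ring

lemma momentumError_eq (t : ℕ) (ω : Ω) :
    momentumError f τ u X M t ω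
      = (1 - β) • maskMul (u (t / τ) ω) (gradient f (X t ω) - M t ω)
        + (-β • maskMul (u (t / τ) ω)) (γ (X t ω) (ξ t ω) - gradient f (X t ω)) := by
  rw [momentumError, maskedGradient, h.M_succ, smul_apply, ← map_sub,
    ← map_smul, ← map_smul, ← map_add]
  congr 1
  module

lemma memLp_maskMul {A : Ω → EuclideanSpace ℝ ι} (hA : MemLp A 2 μ) (hAm : Measurable A) (j : ℕ) :
    MemLp (fun ω => maskMul (u j ω) (A ω)) 2 μ := by
  refine hA.mono (h.measurable_maskMul_comp j hAm).aestronglyMeasurable ?_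
  filter_upwards [h.isMask j] with ω hω using hω.norm_maskMul_le _

lemma integral_mask_mul_sq_gradient (j : ℕ) (i : ι) :
    ∫ ω, u j ω i * gradient f (X (j * τ) ω) i ^ 2 ∂μ
      = (∫ ω, u j ω i ∂μ) * ∫ ω, gradient f (X (j * τ) ω) i ^ 2 ∂μ := by
  have hcoord : Measurable fun x : EuclideanSpace ℝ ι => gradient f x i ^ 2 :=
    ((EuclideanSpace.proj (𝕜 := ℝ) i).continuous.measurable.comp h.measurable_gradient).pow_const 2
  have hind : IndepFun (fun ω => u j ω i) (fun ω => gradient f (X (j * τ) ω) i ^ 2) μ :=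
    ((h.indep_u j i).comp hcoord measurable_id).symm
  exact hind.integral_fun_mul_eq_mul_integral
    ((measurable_pi_apply i).comp (h.measurable_u j)).aestronglyMeasurable
    (hcoord.comp (h.measurable_X _)).aestronglyMeasurable

section Integrability

variable [IsProbabilityMeasure μ]

lemma memLp_gradient {t : ℕ} (hX : MemLp (X t) 2 μ) :
    MemLp (fun ω => gradient f (X t ω)) 2 μ := by
  have hsub : MemLp (fun ω => gradient f (X t ω) - gradient f x₀) 2 μ :=
    (hX.sub (memLp_const x₀)).of_le_mul (c := L)
      ((h.measurable_gradient_X t).sub_const _).aestronglyMeasurable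
      (ae_of_all _ fun ω => h.lipschitz _ _)
  simpa [Pi.add_def] using hsub.add (memLp_const (gradient f x₀))

lemma memLp_maskMul_sub {t : ℕ} (hX : MemLp (X t) 2 μ) (hM : MemLp (M t) 2 μ) :
    MemLp (fun ω => maskMul (u (t / τ) ω) (gradient f (X t ω) - M t ω)) 2 μ :=
  h.memLp_maskMul ((h.memLp_gradient hX).sub hM)
    ((h.measurable_gradient_X t).sub (h.measurable_M t)) _

lemma isCenteredNoise_maskMul {s : ι → ℝ} (hs : IsMask s) (x : EuclideanSpace ℝ ι) :
    IsCenteredNoise D (fun z => (-β • maskMul s) (γ x z - gradient f x)) (β ^ 2 * v) := by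
  have : IsProbabilityMeasure D := by
    rw [← h.law_ξ 0]
    exact Measure.isProbabilityMeasure_map (h.measurable_ξ 0).aemeasurable
  rw [← sq_abs β]
  refine (h.noise x).clm_comp _ fun w => ?_
  rw [smul_apply, norm_smul, norm_neg, Real.norm_eq_abs]
  exact mul_le_mul_of_nonneg_left (hs.norm_maskMul_le w) (abs_nonneg β)

lemma integral_momentumError_le_of_memLp {t : ℕ} (hX : MemLp (X t) 2 μ) (hM : MemLp (M t) 2 μ) :
    Integrable (fun ω => ‖momentumError f τ u X M t ω‖ ^ 2) μ ∧
      ∫ ω, ‖momentumError f τ u X M t ω‖ ^ 2 ∂μ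
        ≤ ∫ ω, (1 - β) ^ 2 * ‖maskMul (u (t / τ) ω) (gradient f (X t ω) - M t ω)‖ ^ 2 ∂μ
          + β ^ 2 * v := by
  let Y (ω : Ω) := (X t ω, M t ω, u (t / τ) ω)
  let A (y : EuclideanSpace ℝ ι × EuclideanSpace ℝ ι × (ι → ℝ)) :=
    (1 - β) • maskMul y.2.2 (gradient f y.1 - y.2.1)
  let Z (y : EuclideanSpace ℝ ι × EuclideanSpace ℝ ι × (ι → ℝ)) (z : Ξ) :=
    (-β • maskMul y.2.2) (γ y.1 z - gradient f y.1)
  have hgrad := h.measurable_gradient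
  have hY : Measurable Y :=
    (h.measurable_X t).prodMk ((h.measurable_M t).prodMk (h.measurable_u _))
  have hA : Measurable A := (measurable_maskMul.comp (Measurable.prodMk (by fun_prop)
    (by fun_prop : Measurable fun y : EuclideanSpace ℝ ι × EuclideanSpace ℝ ι × (ι → ℝ) =>
      gradient f y.1 - y.2.1))).const_smul (1 - β)
  have hZ : Measurable (Function.uncurry Z) := (measurable_maskMul.comp (Measurable.prodMk
    (by fun_prop) ((h.measurable_γ.comp (Measurable.prodMk (by fun_prop) measurable_snd)).sub
      (hgrad.comp (measurable_fst.comp measurable_fst))))).const_smul (-β)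
  have hnoise : ∀ᵐ y ∂(μ.map Y), IsCenteredNoise (μ.map (ξ t)) (Z y) (β ^ 2 * v) := by
    have hmask : ∀ᵐ y ∂(μ.map Y), IsMask y.2.2 :=
      (ae_map_iff hY.aemeasurable
        ((measurable_snd.comp measurable_snd) measurableSet_isMask)).2 (h.isMask _)
    filter_upwards [hmask] with y hy
    rw [h.law_ξ]
    exact h.isCenteredNoise_maskMul hy y.1
  have hA_sq (ω : Ω) : ‖A (Y ω)‖ ^ 2
      = (1 - β) ^ 2 * ‖maskMul (u (t / τ) ω) (gradient f (X t ω) - M t ω)‖ ^ 2 := by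
    rw [norm_smul, mul_pow, Real.norm_eq_abs, sq_abs]
  have hA2 : Integrable (fun ω => ‖A (Y ω)‖ ^ 2) μ := by
    simpa only [hA_sq] using
      ((h.memLp_maskMul_sub hX hM).integrable_norm_pow two_ne_zero).const_mul _
  simpa only [h.momentumError_eq, hA_sq] using
    integrable_and_integral_norm_sq_add_noise_le hY (h.measurable_ξ t) (h.indep_ξ t) hA hZ hA2
      hnoise

lemma memLp_X_M (t : ℕ) : MemLp (X t) 2 μ ∧ MemLp (M t) 2 μ := by
  induction t with
  | zero =>
    rw [funext h.X_zero, funext h.M_zero]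
    exact ⟨memLp_const _, memLp_const _⟩
  | succ t ih =>
    obtain ⟨hX, hM⟩ := ih
    have hgrad := h.measurable_gradient_X t
    have herror : MemLp (momentumError f τ u X M t) 2 μ :=
      (memLp_two_iff_integrable_sq_norm ((h.measurable_maskMul_comp _ hgrad).sub
        (h.measurable_M (t + 1))).aestronglyMeasurable).2
        (h.integral_momentumError_le_of_memLp hX hM).1
    have hM_succ : MemLp (M (t + 1)) 2 μ := by
      have hsub := (h.memLp_maskMul (h.memLp_gradient hX) hgrad (t / τ)).sub herror
      simpa [Pi.sub_def, momentumError, maskedGradient] using hsub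
    refine ⟨(hX.sub (hM_succ.const_smul η)).ae_eq ?_, hM_succ⟩
    exact (h.X_succ_ae t).mono fun ω hω => hω.symm

lemma memLp_gradient_X (t : ℕ) : MemLp (fun ω => gradient f (X t ω)) 2 μ :=
  h.memLp_gradient (h.memLp_X_M t).1

lemma integrable_norm_sq_gradient (t : ℕ) : Integrable (fun ω => ‖gradient f (X t ω)‖ ^ 2) μ :=
  (h.memLp_gradient_X t).integrable_norm_pow two_ne_zero

lemma integrable_norm_sq_maskMul_gradient (t j : ℕ) :
    Integrable (fun ω => ‖maskMul (u j ω) (gradient f (X t ω))‖ ^ 2) μ :=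
  (h.memLp_maskMul (h.memLp_gradient_X t) (h.measurable_gradient_X t) j).integrable_norm_pow
    two_ne_zero

lemma integrable_norm_sq_M (t : ℕ) : Integrable (fun ω => ‖M t ω‖ ^ 2) μ :=
  (h.memLp_X_M t).2.integrable_norm_pow two_ne_zero

lemma integrable_norm_sq_momentumError (t : ℕ) :
    Integrable (fun ω => ‖momentumError f τ u X M t ω‖ ^ 2) μ :=
  (h.integral_momentumError_le_of_memLp (h.memLp_X_M t).1 (h.memLp_X_M t).2).1

lemma integral_momentumError_le (t : ℕ) {B : Ω → ℝ} (hB : Integrable B μ)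
    (hle : ∀ᵐ ω ∂μ,
      (1 - β) ^ 2 * ‖maskMul (u (t / τ) ω) (gradient f (X t ω) - M t ω)‖ ^ 2 ≤ B ω) :
    ∫ ω, ‖momentumError f τ u X M t ω‖ ^ 2 ∂μ ≤ ∫ ω, B ω ∂μ + β ^ 2 * v := by
  obtain ⟨hX, hM⟩ := h.memLp_X_M t
  refine (h.integral_momentumError_le_of_memLp hX hM).2.trans ?_
  exact add_le_add_left (integral_mono_ae
    (((h.memLp_maskMul_sub hX hM).integrable_norm_pow two_ne_zero).const_mul _) hB hle) _

lemma integrable_objective (t : ℕ) : Integrable (fun ω => f (X t ω)) μ := by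
  have hdist : MemLp (fun ω => X t ω - x₀) 2 μ := (h.memLp_X_M t).1.sub (memLp_const x₀)
  have hbound := ((integrable_const (μ := μ) (|f x₀| + |⨅ x, f x|)).add
    ((hdist.integrable one_le_two).norm.const_mul ‖gradient f x₀‖)).add
    ((hdist.integrable_norm_pow two_ne_zero).const_mul (|L| / 2))
  refine hbound.mono' (h.differentiable.continuous.measurable.comp
    (h.measurable_X t)).aestronglyMeasurable (ae_of_all _ fun ω => ?_)
  simpa using abs_le_of_lipschitz_gradient h.differentiable h.lipschitz h.iInf_le x₀ (X t ω - x₀)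

end Integrability

section Estimates

variable [IsProbabilityMeasure μ]

lemma mul_integral_norm_sq_gradient_le (j : ℕ) :
    δ * ∫ ω, ‖gradient f (X (j * τ) ω)‖ ^ 2 ∂μ
      ≤ ∫ ω, ‖maskMul (u j ω) (gradient f (X (j * τ) ω))‖ ^ 2 ∂μ := by
  have hcoord (i : ι) : Integrable (fun ω => gradient f (X (j * τ) ω) i ^ 2) μ := by
    simpa using ((EuclideanSpace.proj (𝕜 := ℝ) i).comp_memLp'
      (h.memLp_gradient_X (j * τ))).integrable_norm_pow two_ne_zero
  have hmasked (i : ι) : Integrable (fun ω => u j ω i * gradient f (X (j * τ) ω) i ^ 2) μ := by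
    refine (hcoord i).mono' (((measurable_pi_apply i).comp
      (h.measurable_u j)).aestronglyMeasurable.mul (hcoord i).aestronglyMeasurable) ?_
    filter_upwards [h.isMask j] with ω hω
    rcases hω i with h0 | h1
    · simpa [h0] using sq_nonneg _
    · simp [h1]
  calc δ * ∫ ω, ‖gradient f (X (j * τ) ω)‖ ^ 2 ∂μ
      = ∑ i, δ * ∫ ω, gradient f (X (j * τ) ω) i ^ 2 ∂μ := by
        simp only [EuclideanSpace.real_norm_sq_eq]
        rw [integral_finsetSum _ fun i _ => hcoord i, Finset.mul_sum]
    _ ≤ ∑ i, (∫ ω, u j ω i ∂μ) * ∫ ω, gradient f (X (j * τ) ω) i ^ 2 ∂μ := by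
        exact Finset.sum_le_sum fun i _ => mul_le_mul_of_nonneg_right (h.le_mask_mean j i)
          (integral_nonneg fun ω => sq_nonneg _)
    _ = ∫ ω, ∑ i, u j ω i * gradient f (X (j * τ) ω) i ^ 2 ∂μ := by
        rw [integral_finsetSum _ fun i _ => hmasked i]
        exact Finset.sum_congr rfl fun i _ => (h.integral_mask_mul_sq_gradient j i).symm
    _ = _ := by
        refine integral_congr_ae ?_
        filter_upwards [h.isMask j] with ω hω
        rw [hω.norm_sq_maskMul]

lemma integral_momentumError_zero_le (hβ : 0 < β) (hβ1 : β ≤ 1) :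
    ∫ ω, ‖momentumError f τ u X M 0 ω‖ ^ 2 ∂μ
      ≤ β ^ 2 * v + ∫ ω, ‖gradient f (X 0 ω)‖ ^ 2 ∂μ := by
  rw [add_comm]
  refine h.integral_momentumError_le 0 (h.integrable_norm_sq_gradient 0) ?_
  filter_upwards [h.isMask (0 / τ)] with ω hω
  rw [h.M_zero, sub_zero]
  exact (mul_le_of_le_one_left (sq_nonneg _) (pow_le_one₀ (by linarith) (by linarith))).trans
    (hω.norm_sq_maskMul_le _)

lemma integral_momentumError_succ_le (hβ : 0 < β) (hβ1 : β ≤ 1) (hη : 0 ≤ η) (t : ℕ) :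
    ∫ ω, ‖momentumError f τ u X M (t + 1) ω‖ ^ 2 ∂μ
      ≤ (1 - β) * ∫ ω, ‖momentumError f τ u X M t ω‖ ^ 2 ∂μ
        + (L * η) ^ 2 / β * ∫ ω, ‖M (t + 1) ω‖ ^ 2 ∂μ + β ^ 2 * v
        + if τ ∣ t + 1 then ∫ ω, ‖gradient f (X (t + 1) ω)‖ ^ 2 ∂μ else 0 := by
  have herror := (h.integrable_norm_sq_momentumError t).const_mul (1 - β)
  have hmomentum := (h.integrable_norm_sq_M (t + 1)).const_mul ((L * η) ^ 2 / β)
  have hgrad := h.integrable_norm_sq_gradient (t + 1)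
  rw [← integral_const_mul (1 - β), ← integral_const_mul ((L * η) ^ 2 / β),
    add_right_comm _ (β ^ 2 * v)]
  split_ifs with hdvd
  · rw [← integral_add' herror hmomentum, ← integral_add' (herror.add hmomentum) hgrad]
    refine h.integral_momentumError_le _ ((herror.add hmomentum).add hgrad) ?_
    filter_upwards [h.isMask (t / τ), h.isMask ((t + 1) / τ), h.maskMul_M_succ t,
      h.norm_gradient_sub_le hη t] with ω hold hnew hM hstep
    exact hold.momentum_error_le_of_mask_change hnew hβ hβ1 hM hstep
  · have hdiv : (t + 1) / τ = t / τ := by rw [Nat.succ_div, if_neg hdvd, add_zero]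
    rw [add_zero, ← integral_add' herror hmomentum]
    refine h.integral_momentumError_le _ (herror.add hmomentum) ?_
    filter_upwards [h.isMask (t / τ), h.maskMul_M_succ t,
      h.norm_gradient_sub_le hη t] with ω hmask hM hstep
    rw [hdiv]
    exact hmask.momentum_error_le hβ hβ1 hM hstep

lemma integral_objective_succ_le (hη : 0 ≤ η) (hLη : L * η ≤ 1 / 4) (t : ℕ) :
    ∫ ω, f (X (t + 1) ω) ∂μ ≤ ∫ ω, f (X t ω) ∂μ
      - η / 2 * ∫ ω, ‖maskedGradient f τ u X t ω‖ ^ 2 ∂μ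
      - 3 * η / 8 * ∫ ω, ‖M (t + 1) ω‖ ^ 2 ∂μ
      + η / 2 * ∫ ω, ‖momentumError f τ u X M t ω‖ ^ 2 ∂μ := by
  have hobj := h.integrable_objective t
  have hmasked : Integrable (fun ω => η / 2 * ‖maskedGradient f τ u X t ω‖ ^ 2) μ :=
    (h.integrable_norm_sq_maskMul_gradient t (t / τ)).const_mul (η / 2)
  have hmomentum := (h.integrable_norm_sq_M (t + 1)).const_mul (3 * η / 8)
  have herror := (h.integrable_norm_sq_momentumError t).const_mul (η / 2)
  simp only [← integral_const_mul]
  rw [← integral_sub' hobj hmasked, ← integral_sub' (hobj.sub hmasked) hmomentum,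
    ← integral_add' ((hobj.sub hmasked).sub hmomentum) herror]
  refine integral_mono_ae (h.integrable_objective _)
    (((hobj.sub hmasked).sub hmomentum).add herror) ?_
  filter_upwards [h.maskMul_M_succ t, h.X_succ_ae t] with ω hM hX
  have hquad := le_quadratic_of_lipschitz_gradient h.differentiable h.lipschitz (X t ω)
    (-(η • M (t + 1) ω))
  rw [← sub_eq_add_neg, ← hX, add_assoc, quadratic_eq_of_maskMul_eq hM] at hquad
  have hcoef : 3 * η / 8 * ‖M (t + 1) ω‖ ^ 2 ≤ η / 2 * (1 - L * η) * ‖M (t + 1) ω‖ ^ 2 := by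
    gcongr; nlinarith
  simp only [Pi.add_apply, Pi.sub_apply, momentumError, maskedGradient]
  linarith

lemma integrable_drift (j : ℕ) : Integrable
    (fun ω => (L * η) ^ 2 * τ * ∑ s ∈ Finset.range τ, ‖M (j * τ + s + 1) ω‖ ^ 2) μ :=
  (integrable_finsetSum _ fun s _ => h.integrable_norm_sq_M (j * τ + s + 1)).const_mul _

lemma integral_drift (j : ℕ) :
    ∫ ω, (L * η) ^ 2 * τ * ∑ s ∈ Finset.range τ, ‖M (j * τ + s + 1) ω‖ ^ 2 ∂μ
      = (L * η) ^ 2 * τ * ∑ s ∈ Finset.range τ, ∫ ω, ‖M (j * τ + s + 1) ω‖ ^ 2 ∂μ := by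
  rw [integral_const_mul, integral_finsetSum _ fun s _ => h.integrable_norm_sq_M (j * τ + s + 1)]

lemma le_integral_maskedGradient (j : ℕ) {r : ℕ} (hr : r < τ) :
    δ / 2 * ∫ ω, ‖gradient f (X (j * τ) ω)‖ ^ 2 ∂μ
        - (L * η) ^ 2 * τ * ∑ s ∈ Finset.range τ, ∫ ω, ‖M (j * τ + s + 1) ω‖ ^ 2 ∂μ
      ≤ ∫ ω, ‖maskedGradient f τ u X (j * τ + r) ω‖ ^ 2 ∂μ := by
  have hdiv : (j * τ + r) / τ = j := by
    rw [mul_comm, Nat.mul_add_div (by lia), Nat.div_eq_of_lt hr, add_zero]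
  have hfresh := (h.integrable_norm_sq_maskMul_gradient (j * τ) j).const_mul (1 / 2)
  have hdrifted : ∫ ω, (1 / 2 * ‖maskMul (u j ω) (gradient f (X (j * τ) ω))‖ ^ 2
      - (L * η) ^ 2 * τ * ∑ s ∈ Finset.range τ, ‖M (j * τ + s + 1) ω‖ ^ 2) ∂μ
      ≤ ∫ ω, ‖maskMul (u j ω) (gradient f (X (j * τ + r) ω))‖ ^ 2 ∂μ := by
    refine integral_mono_ae (hfresh.sub (h.integrable_drift j))
      (h.integrable_norm_sq_maskMul_gradient _ _) ?_
    filter_upwards [h.isMask j, h.norm_sq_gradient_drift_le j hr] with ω hmask hdrift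
    have hsplit := norm_sq_le_two_mul_add (maskMul (u j ω) (gradient f (X (j * τ) ω)))
      (maskMul (u j ω) (gradient f (X (j * τ + r) ω)))
    rw [norm_sub_rev, ← map_sub] at hsplit
    linarith [hmask.norm_sq_maskMul_le (gradient f (X (j * τ + r) ω) - gradient f (X (j * τ) ω))]
  rw [integral_sub hfresh (h.integrable_drift j), integral_const_mul, h.integral_drift] at hdrifted
  simp only [maskedGradient, hdiv]
  linarith [h.mul_integral_norm_sq_gradient_le j]

lemma integral_norm_sq_gradient_le (j : ℕ) {r : ℕ} (hr : r < τ) :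
    ∫ ω, ‖gradient f (X (j * τ + r) ω)‖ ^ 2 ∂μ
      ≤ 2 * ∫ ω, ‖gradient f (X (j * τ) ω)‖ ^ 2 ∂μ + 2 * ((L * η) ^ 2 * τ
          * ∑ s ∈ Finset.range τ, ∫ ω, ‖M (j * τ + s + 1) ω‖ ^ 2 ∂μ) := by
  have hstart := (h.integrable_norm_sq_gradient (j * τ)).const_mul 2
  have hdrift := (h.integrable_drift j).const_mul 2
  rw [← h.integral_drift j, ← integral_const_mul 2, ← integral_const_mul 2,
    ← integral_add hstart hdrift]
  refine integral_mono_ae (h.integrable_norm_sq_gradient _) (hstart.add hdrift) ?_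
  filter_upwards [h.norm_sq_gradient_drift_le j hr] with ω hω
  linarith [norm_sq_le_two_mul_add (gradient f (X (j * τ + r) ω)) (gradient f (X (j * τ) ω))]

theorem energyEstimates (hβ : 0 < β) (hβ1 : β ≤ 1) (hη : 0 ≤ η) (hLη : L * η ≤ 1 / 4) :
    EnergyEstimates β δ η ((L * η) ^ 2) v τ
      (fun t => ∫ ω, ‖gradient f (X t ω)‖ ^ 2 ∂μ)
      (fun t => ∫ ω, ‖maskedGradient f τ u X t ω‖ ^ 2 ∂μ)
      (fun t => ∫ ω, ‖M (t + 1) ω‖ ^ 2 ∂μ)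
      (fun t => ∫ ω, ‖momentumError f τ u X M t ω‖ ^ 2 ∂μ)
      (fun t => ∫ ω, f (X t ω) ∂μ) where
  grad_nonneg _ := integral_nonneg fun _ => sq_nonneg _
  momentum_nonneg _ := integral_nonneg fun _ => sq_nonneg _
  error_nonneg _ := integral_nonneg fun _ => sq_nonneg _
  error_zero := h.integral_momentumError_zero_le hβ hβ1
  error_succ := h.integral_momentumError_succ_le hβ hβ1 hη
  descent := h.integral_objective_succ_le hη hLη
  masked_ge j _ hr := h.le_integral_maskedGradient j hr
  grad_le j _ hr := h.integral_norm_sq_gradient_le j hr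

theorem sum_integral_norm_sq_gradient_le (hδ : 0 < δ) (hδ1 : δ ≤ 1) (hadm : Admissible δ L β τ η)
    (K : ℕ) :
    ∑ t ∈ Finset.range (K * τ), ∫ ω, ‖gradient f (X t ω)‖ ^ 2 ∂μ
      ≤ 16 * (f x₀ - ⨅ x, f x) / (δ * η) + 32 * β * v / (3 * δ) * (K * τ) := by
  have hlower (t : ℕ) : ⨅ x, f x ≤ ∫ ω, f (X t ω) ∂μ := by
    simpa using integral_mono (integrable_const _) (h.integrable_objective t)
      fun ω => h.iInf_le (X t ω)
  have hsum := (h.energyEstimates hadm.beta_pos hadm.beta_le_one hadm.eta_pos.le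
    hadm.mul_eta_le).sum_grad_le_gap_add_noise hadm.beta_pos hadm.beta_le_one hδ hδ1 hadm.eta_pos
    (sq_nonneg _) (h.noise x₀).nonneg hadm.le_tau hadm.sq_mul_eta_le hadm.sq_mul_eta_mul_sq_le
    hlower K
  simpa [h.X_zero] using hsum

theorem average_integral_norm_sq_gradient_le (hδ : 0 < δ) (hδ1 : δ ≤ 1)
    (hadm : Admissible δ L β τ η) {K : ℕ} (hK : 1 ≤ K) :
    1 / ((K : ℝ) * τ) * ∑ t ∈ Finset.range (K * τ), ∫ ω, ‖gradient f (X t ω)‖ ^ 2 ∂μ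
      ≤ 16 * (f x₀ - ⨅ x, f x) / (δ * η * K * τ) + 32 * β * v / (3 * δ) := by
  have hη := hadm.eta_pos
  have hτ := hadm.tau_pos hδ
  have : 0 < (K : ℝ) * τ := by positivity
  calc _ ≤ 1 / ((K : ℝ) * τ)
          * (16 * (f x₀ - ⨅ x, f x) / (δ * η) + 32 * β * v / (3 * δ) * (K * τ)) := by
        gcongr; exact h.sum_integral_norm_sq_gradient_le hδ hδ1 hadm K
    _ = _ := by field_simp

theorem average_first_integral_norm_sq_gradient_le (hδ : 0 < δ) (hδ1 : δ ≤ 1)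
    (hadm : Admissible δ L β τ η) {T : ℕ} (hT : 0 < T) (hτT : τ ≤ T) :
    1 / (T : ℝ) * ∑ t ∈ Finset.range T, ∫ ω, ‖gradient f (X t ω)‖ ^ 2 ∂μ
      ≤ 16 * (f x₀ - ⨅ x, f x) / (δ * η * T) + 64 * β * v / (3 * δ) := by
  have hβ := hadm.beta_pos
  have hη := hadm.eta_pos
  have hv := (h.noise x₀).nonneg
  -- `T / τ + 1` full periods cover the first `T` iterations and comprise at most `2 * T`.
  have hcover : T ≤ (T / τ + 1) * τ := by
    rw [add_one_mul]
    exact (Nat.lt_div_mul_add (hadm.tau_pos hδ)).le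
  have hperiods : ((T / τ + 1 : ℕ) : ℝ) * τ ≤ 2 * T := by
    have := Nat.div_mul_le_self T τ
    exact_mod_cast (by rw [add_one_mul]; lia : (T / τ + 1) * τ ≤ 2 * T)
  calc _ ≤ 1 / (T : ℝ) * ∑ t ∈ Finset.range ((T / τ + 1) * τ),
          ∫ ω, ‖gradient f (X t ω)‖ ^ 2 ∂μ := by
        refine mul_le_mul_of_nonneg_left (Finset.sum_le_sum_of_subset_of_nonneg
          (Finset.range_mono hcover) fun _ _ _ => ?_) (by positivity)
        exact integral_nonneg fun _ => sq_nonneg _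
    _ ≤ 1 / (T : ℝ) * (16 * (f x₀ - ⨅ x, f x) / (δ * η) + 32 * β * v / (3 * δ) * (2 * T)) := by
        refine mul_le_mul_of_nonneg_left ((h.sum_integral_norm_sq_gradient_le hδ hδ1 hadm _).trans
          ?_) (by positivity)
        gcongr
    _ = _ := by field_simp; ring

end Estimates

omit h in
theorem average_tuned_integral_norm_sq_gradient_le [IsProbabilityMeasure μ] {σ Δ : ℝ} {T : ℕ}
    (h : IsMaskedMSGD D μ f γ L (σ ^ 2) δ (tunedBeta δ σ L Δ T) (tunedEta δ σ L Δ T)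
      (tunedTau δ σ L Δ T) x₀ ξ u X M)
    (hδ : 0 < δ) (hδ1 : δ ≤ 1) (hL : 0 < L) (hΔ : 0 < Δ) (hgap : f x₀ - ⨅ x, f x = Δ)
    (hT : minIterations δ σ L Δ ≤ T) :
    1 / (T : ℝ) * ∑ t ∈ Finset.range T, ∫ ω, ‖gradient f (X t ω)‖ ^ 2 ∂μ
      ≤ 2600 * convergenceRate δ σ L Δ T := by
  have hT0 := pos_of_minIterations_le hδ hL hΔ hT
  refine (h.average_first_integral_norm_sq_gradient_le hδ hδ1 (tuned_admissible hδ hL) hT0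
    (tunedTau_le hδ hL hΔ hT)).trans ?_
  rw [hgap]
  exact tuned_bound_le hδ hδ1 hL hΔ hT0

end IsMaskedMSGD

end MaskedMSGD

section UniformMasks

lemma map_uniformOn {α : Type*} [MeasurableSpace α] [MeasurableSingletonClass α] (e : α ≃ᵐ α)
    {s : Set α} (hs : e ⁻¹' s = s) : (uniformOn s).map e = uniformOn s := by
  ext t ht
  have hcount : Measure.count (s ∩ e ⁻¹' t) = Measure.count (s ∩ t) := by
    nth_rw 1 [← hs]
    rw [← Set.preimage_inter, ← e.image_symm, Measure.count_injective_image e.symm.injective]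
  rw [Measure.map_apply e.measurable ht, uniformOn, cond_apply' (e.measurable ht), cond_apply' ht,
    hcount]

variable {a b k : ℕ}

instance (a b : ℕ) : MeasurableSingletonClass (Matrix (Fin a) (Fin b) ℝ) :=
  inferInstanceAs (MeasurableSingletonClass (Fin a → Fin b → ℝ))

lemma measurable_entry (i : Fin a) (j : Fin b) :
    Measurable fun S : Matrix (Fin a) (Fin b) ℝ => S i j :=
  (measurable_pi_apply j).comp
    (measurable_pi_apply (X := fun _ : Fin a => Fin b → ℝ) i)

lemma frobSq_eq_sum_prod (S : Matrix (Fin a) (Fin b) ℝ) :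
    frobSq S = ∑ p : Fin a × Fin b, S p.1 p.2 ^ 2 :=
  (Fintype.sum_prod_type' fun i j => S i j ^ 2).symm

lemma finite_sparseMasks : (sparseMasks a b k).Finite := by
  have hfin : (Set.univ.pi fun _ : Fin a => Set.univ.pi fun _ : Fin b => ({0, 1} : Set ℝ)).Finite :=
    Set.Finite.pi fun _ => Set.Finite.pi fun _ => Set.toFinite _
  exact hfin.subset fun S hS => by simpa [Set.mem_pi] using hS.1

lemma sum_entry_of_mem_sparseMasks {S : Matrix (Fin a) (Fin b) ℝ} (hS : S ∈ sparseMasks a b k) :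
    ∑ p : Fin a × Fin b, S p.1 p.2 = k := by
  rw [← hS.2, frobSq_eq_sum_prod]
  refine Finset.sum_congr rfl fun p _ => ?_
  rcases hS.1 p.1 p.2 with h | h <;> simp [h]

/-- The permutation of the space of matrices that exchanges the entries at `p` and `q`. -/
def swapEntries (p q : Fin a × Fin b) :
    Matrix (Fin a) (Fin b) ℝ ≃ᵐ Matrix (Fin a) (Fin b) ℝ :=
  MeasurableEquiv.ofInvolutive
    (fun S => Matrix.of fun i j => S (Equiv.swap p q (i, j)).1 (Equiv.swap p q (i, j)).2)
    (fun S => by ext i j; simp)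
    (measurable_pi_lambda _ fun _ => measurable_pi_lambda _ fun _ => measurable_entry _ _)

lemma swapEntries_apply (p q : Fin a × Fin b) (S : Matrix (Fin a) (Fin b) ℝ) (i : Fin a)
    (j : Fin b) :
    swapEntries p q S i j = S (Equiv.swap p q (i, j)).1 (Equiv.swap p q (i, j)).2 := rfl

lemma frobSq_swapEntries (p q : Fin a × Fin b) (S : Matrix (Fin a) (Fin b) ℝ) :
    frobSq (swapEntries p q S) = frobSq S := by
  simp only [frobSq_eq_sum_prod, swapEntries_apply]
  exact Equiv.sum_comp (Equiv.swap p q) fun r => S r.1 r.2 ^ 2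

lemma swapEntries_mem_sparseMasks {p q : Fin a × Fin b} {S : Matrix (Fin a) (Fin b) ℝ}
    (hS : S ∈ sparseMasks a b k) : swapEntries p q S ∈ sparseMasks a b k :=
  ⟨fun _ _ => hS.1 _ _, (frobSq_swapEntries p q S).trans hS.2⟩

lemma preimage_swapEntries_sparseMasks (p q : Fin a × Fin b) :
    swapEntries p q ⁻¹' sparseMasks a b k = sparseMasks a b k := by
  refine Set.Subset.antisymm (fun S hS => ?_) fun S => swapEntries_mem_sparseMasks
  exact (swapEntries p q).left_inv S ▸ swapEntries_mem_sparseMasks (p := p) (q := q) hS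

lemma integral_entry_sparseMasks_eq (p q : Fin a × Fin b) :
    ∫ S, S p.1 p.2 ∂(uniformOn (sparseMasks a b k))
      = ∫ S, S q.1 q.2 ∂(uniformOn (sparseMasks a b k)) := by
  rw [← map_uniformOn (swapEntries p q) (preimage_swapEntries_sparseMasks p q),
    integral_map_equiv, map_uniformOn _ (preimage_swapEntries_sparseMasks p q)]
  simp only [swapEntries_apply, Prod.mk.eta, Equiv.swap_apply_left]

lemma ae_mem_sparseMasks :
    ∀ᵐ S ∂(uniformOn (sparseMasks a b k)), S ∈ sparseMasks a b k :=
  ae_cond_mem finite_sparseMasks.measurableSet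

lemma integrable_entry_sparseMasks (i : Fin a) (j : Fin b) :
    Integrable (fun S => S i j) (uniformOn (sparseMasks a b k)) := by
  refine .of_bound (measurable_entry i j).aestronglyMeasurable 1 ?_
  filter_upwards [ae_mem_sparseMasks] with S hS
  rcases hS.1 i j with h | h <;> simp [h]

lemma integral_entry_sparseMasks [IsProbabilityMeasure (uniformOn (sparseMasks a b k))]
    (i : Fin a) (j : Fin b) :
    ∫ S, S i j ∂(uniformOn (sparseMasks a b k)) = k / (a * b) := by
  have hab : (0 : ℝ) < a * b :=
    mul_pos (by exact_mod_cast i.pos) (by exact_mod_cast j.pos)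
  rw [eq_div_iff hab.ne']
  calc (∫ S, S i j ∂(uniformOn (sparseMasks a b k))) * (a * b)
      = ∑ p : Fin a × Fin b, ∫ S, S p.1 p.2 ∂(uniformOn (sparseMasks a b k)) := by
        rw [Finset.sum_congr rfl fun p _ => integral_entry_sparseMasks_eq p (i, j)]
        simp [mul_comm]
    _ = ∫ S, ∑ p : Fin a × Fin b, S p.1 p.2 ∂(uniformOn (sparseMasks a b k)) :=
        (integral_finsetSum _ fun p _ => integrable_entry_sparseMasks p.1 p.2).symm
    _ = ∫ _, (k : ℝ) ∂(uniformOn (sparseMasks a b k)) := by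
        refine integral_congr_ae ?_
        filter_upwards [ae_mem_sparseMasks] with S hS using sum_entry_of_mem_sparseMasks hS
    _ = k := by simp

end UniformMasks

section Layers

variable {N : ℕ} {m n : Fin N → ℕ}

lemma sum_frobSq_layer (x : Params m n) : ∑ ℓ, frobSq (layer x ℓ) = ‖x‖ ^ 2 := by
  rw [EuclideanSpace.real_norm_sq_eq, Fintype.sum_sigma]
  exact Finset.sum_congr rfl fun ℓ _ => frobSq_eq_sum_prod _

/-- A family of layer masks as a single mask on the coordinates of the parameter space. -/
def flatMask (S : Layers m n) (p : (ℓ : Fin N) × (Fin (m ℓ) × Fin (n ℓ))) : ℝ :=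
  S p.1 p.2.1 p.2.2

lemma minDensity_le (k : Fin N → ℕ) (ℓ : Fin N) :
    minDensity m n k ≤ (k ℓ : ℝ) / ((m ℓ : ℝ) * (n ℓ : ℝ)) :=
  ciInf_le (Set.finite_range _).bddBelow ℓ

lemma minDensity_pos {k : Fin N → ℕ} (hN : 0 < N) (hk : ∀ ℓ, 1 ≤ k ℓ)
    (hkmn : ∀ ℓ, k ℓ ≤ m ℓ * n ℓ) : 0 < minDensity m n k := by
  have : Nonempty (Fin N) := ⟨⟨0, hN⟩⟩
  obtain ⟨ℓ, hℓ⟩ := exists_eq_ciInf_of_finite (f := fun ℓ => (k ℓ : ℝ) / ((m ℓ : ℝ) * (n ℓ : ℝ)))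
  rw [minDensity, ← hℓ]
  exact div_pos (by exact_mod_cast hk ℓ) (by exact_mod_cast (hk ℓ).trans (hkmn ℓ))

lemma minDensity_le_one {k : Fin N → ℕ} (hN : 0 < N) (hkmn : ∀ ℓ, k ℓ ≤ m ℓ * n ℓ) :
    minDensity m n k ≤ 1 :=
  (minDensity_le k ⟨0, hN⟩).trans
    (div_le_one_of_le₀ (by exact_mod_cast hkmn ⟨0, hN⟩) (by positivity))

end Layers

section StochasticGradients

variable {N : ℕ} {m n : Fin N → ℕ} {Ξ : Type*} [MeasurableSpace Ξ] {D : Measure Ξ}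
  {F : Params m n → Ξ → ℝ} {σ : Fin N → ℝ}

lemma sum_frobSq_layerGrad_sub (x : Params m n) (s : Ξ) :
    ∑ ℓ, frobSq (layerGrad (fun y => F y s) x ℓ - layerGrad (objective F D) x ℓ)
      = ‖gradient (fun y => F y s) x - gradient (objective F D) x‖ ^ 2 :=
  sum_frobSq_layer (gradient (fun y => F y s) x - gradient (objective F D) x)

namespace StochasticGradient

variable (hG : StochasticGradient F D σ)
include hG

lemma integrable_norm_sq (x : Params m n) :
    Integrable (fun s => ‖gradient (fun y => F y s) x - gradient (objective F D) x‖ ^ 2) D := by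
  simp only [← sum_frobSq_layerGrad_sub]
  exact integrable_finsetSum _ fun ℓ _ => hG.integrable_sq x ℓ

lemma integral_norm_sq_le (x : Params m n) :
    ∫ s, ‖gradient (fun y => F y s) x - gradient (objective F D) x‖ ^ 2 ∂D
      ≤ totalNoise σ ^ 2 := by
  simp only [← sum_frobSq_layerGrad_sub]
  rw [integral_finsetSum _ fun ℓ _ => hG.integrable_sq x ℓ, totalNoise,
    Real.sq_sqrt (Finset.sum_nonneg fun ℓ _ => sq_nonneg _)]
  exact Finset.sum_le_sum fun ℓ _ => hG.variance_le x ℓ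

lemma integrable_gradient (x : Params m n) :
    Integrable (fun s => gradient (fun y => F y s) x) D :=
  .of_eval_piLp fun p => hG.integrable x p.1 p.2.1 p.2.2

lemma integral_gradient (x : Params m n) :
    ∫ s, gradient (fun y => F y s) x ∂D = gradient (objective F D) x := by
  ext p
  rw [eval_integral_piLp fun p => hG.integrable x p.1 p.2.1 p.2.2]
  exact hG.unbiased x p.1 p.2.1 p.2.2

lemma isCenteredNoise [IsProbabilityMeasure D] (x : Params m n) :
    IsCenteredNoise D (fun s => gradient (fun y => F y s) x - gradient (objective F D) x)
      (totalNoise σ ^ 2) where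
  memLp := (memLp_two_iff_integrable_sq_norm
    ((hG.integrable_gradient x).aestronglyMeasurable.sub aestronglyMeasurable_const)).2
    (hG.integrable_norm_sq x)
  integral_eq_zero := by
    rw [integral_sub (hG.integrable_gradient x) (integrable_const _), hG.integral_gradient]
    simp
  integral_norm_sq_le := hG.integral_norm_sq_le x

end StochasticGradient

end StochasticGradients

section Recursion

variable {N : ℕ} {m n : Fin N → ℕ} {Ξ Ω : Type*}

lemma vec_step_M (F : Params m n → Ξ → ℝ) (β : ℝ) (τ : ℕ) (η : ℝ) (t : ℕ) (s : Ξ)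
    (newMasks : Layers m n) (st : State m n) :
    vec (step F β τ η t s newMasks st).M
      = maskMul (flatMask (step F β τ η t s newMasks st).S)
          ((1 - β) • vec st.M + β • gradient (fun y => F y s) st.x) := by
  ext p
  simp only [vec, step, flatMask, layerGrad, layer, maskMul_apply, PiLp.add_apply,
    PiLp.smul_apply, smul_eq_mul, Matrix.add_apply, Matrix.smul_apply, Matrix.hadamard_apply,
    Matrix.of_apply]
  ring

lemma step_x (F : Params m n → Ξ → ℝ) (β : ℝ) (τ : ℕ) (η : ℝ) (t : ℕ) (s : Ξ)
    (newMasks : Layers m n) (st : State m n) :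
    (step F β τ η t s newMasks st).x = st.x
      - η • maskMul (flatMask (step F β τ η t s newMasks st).S)
          (vec (step F β τ η t s newMasks st).M) :=
  rfl

variable (F : Params m n → Ξ → ℝ) (β : ℝ) (τ : ℕ) (η : ℝ) (x₀ : Params m n)
  (ξ : ℕ → Ω → Ξ) (U : ℕ → (ℓ : Fin N) → Ω → Matrix (Fin (m ℓ)) (Fin (n ℓ)) ℝ)

lemma process_succ (t : ℕ) (ω : Ω) :
    process F β τ η x₀ ξ U (t + 1) ω
      = step F β τ η t (ξ t ω) (fun ℓ => U (t / τ) ℓ ω) (process F β τ η x₀ ξ U t ω) :=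
  rfl

lemma process_S_succ (t : ℕ) (ω : Ω) :
    (process F β τ η x₀ ξ U (t + 1) ω).S = fun ℓ => U (t / τ) ℓ ω := by
  induction t with
  | zero => simp [process_succ, step]
  | succ t ih =>
    by_cases hτ : (t + 1) % τ = 0
    · simp only [process_succ _ _ _ _ _ _ _ (t + 1), step, if_pos hτ]
    · have same_period : (t + 1) / τ = t / τ := by
        rw [Nat.succ_div, if_neg fun hdvd => hτ (Nat.mod_eq_zero_of_dvd hdvd), add_zero]
      simp only [process_succ _ _ _ _ _ _ _ (t + 1), step, if_neg hτ, ih, same_period]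

lemma vec_process_M_succ (t : ℕ) (ω : Ω) :
    vec (process F β τ η x₀ ξ U (t + 1) ω).M
      = maskMul (flatMask fun ℓ => U (t / τ) ℓ ω)
          ((1 - β) • vec (process F β τ η x₀ ξ U t ω).M
            + β • gradient (fun y => F y (ξ t ω)) (process F β τ η x₀ ξ U t ω).x) := by
  rw [← process_S_succ F β τ η x₀ ξ U t ω, process_succ, vec_step_M]

lemma process_x_succ (t : ℕ) (ω : Ω) :
    (process F β τ η x₀ ξ U (t + 1) ω).x = (process F β τ η x₀ ξ U t ω).x
      - η • maskMul (flatMask fun ℓ => U (t / τ) ℓ ω)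
          (vec (process F β τ η x₀ ξ U (t + 1) ω).M) := by
  rw [← process_S_succ F β τ η x₀ ξ U t ω, process_succ, step_x]

lemma process_calls (t : ℕ) (ω : Ω) : (process F β τ η x₀ ξ U t ω).calls = t := by
  induction t with
  | zero => rfl
  | succ t ih => exact congrArg (· + 1) ih

end Recursion

section Sampling

variable {N : ℕ} {m n k : Fin N → ℕ} {Ξ Ω : Type*} [MeasurableSpace Ξ]
  {F : Params m n → Ξ → ℝ} {ξ : ℕ → Ω → Ξ}
  {U : ℕ → (ℓ : Fin N) → Ω → Matrix (Fin (m ℓ)) (Fin (n ℓ)) ℝ}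

/-- The `σ`-algebra generated by a single draw: `Sum.inl t` stands for the data sample `ξ t`, and
`Sum.inr (j, ℓ)` for the mask `U j ℓ`, as in `IsSampling.indep`. -/
abbrev drawAlgebra (ξ : ℕ → Ω → Ξ) (U : ℕ → (ℓ : Fin N) → Ω → Matrix (Fin (m ℓ)) (Fin (n ℓ)) ℝ)
    (i : ℕ ⊕ (ℕ × Fin N)) : MeasurableSpace Ω :=
  Sum.elim (fun t => MeasurableSpace.comap (ξ t) inferInstance)
    (fun p => MeasurableSpace.comap (U p.1 p.2) inferInstance) i

/-- The `σ`-algebra generated by the draws in `A`. -/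
abbrev drawsAlgebra (ξ : ℕ → Ω → Ξ) (U : ℕ → (ℓ : Fin N) → Ω → Matrix (Fin (m ℓ)) (Fin (n ℓ)) ℝ)
    (A : Set (ℕ ⊕ (ℕ × Fin N))) : MeasurableSpace Ω :=
  ⨆ i ∈ A, drawAlgebra ξ U i

/-- The data samples of the iterations before `t` and the masks of the periods in `J`. -/
def pastDraws (N t : ℕ) (J : Set ℕ) : Set (ℕ ⊕ (ℕ × Fin N)) :=
  {i | Sum.elim (· < t) (fun p => p.1 ∈ J) i}

lemma pastDraws_mono {t t' : ℕ} {J J' : Set ℕ} (ht : t ≤ t') (hJ : J ⊆ J') :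
    pastDraws N t J ⊆ pastDraws N t' J' := by
  rintro (s | p) hi
  · exact lt_of_lt_of_le (show s < t from hi) ht
  · exact hJ hi

lemma drawsAlgebra_mono {A B : Set (ℕ ⊕ (ℕ × Fin N))} (h : A ⊆ B) :
    drawsAlgebra ξ U A ≤ drawsAlgebra ξ U B :=
  biSup_mono h

lemma measurable_data_drawsAlgebra {A : Set (ℕ ⊕ (ℕ × Fin N))} {t : ℕ} (h : Sum.inl t ∈ A) :
    Measurable[drawsAlgebra ξ U A] (ξ t) :=
  (comap_measurable (ξ t)).mono (le_biSup (drawAlgebra ξ U) h) le_rfl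

lemma measurable_mask_drawsAlgebra {A : Set (ℕ ⊕ (ℕ × Fin N))} {j : ℕ}
    (h : ∀ ℓ, Sum.inr (j, ℓ) ∈ A) :
    Measurable[drawsAlgebra ξ U A] fun ω => flatMask fun ℓ => U j ℓ ω := by
  refine @measurable_pi_lambda _ _ _ (drawsAlgebra ξ U A) _ _ fun p => ?_
  exact (measurable_entry p.2.1 p.2.2).comp
    ((comap_measurable (U j p.1)).mono (le_biSup (drawAlgebra ξ U) (h p.1)) le_rfl)

lemma measurable_process_succ {_ : MeasurableSpace Ω}
    (hγ : Measurable fun p : Params m n × Ξ => gradient (fun y => F y p.2) p.1)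
    {β : ℝ} {τ : ℕ} {η : ℝ} {x₀ : Params m n} {t : ℕ}
    (hx : Measurable fun ω => (process F β τ η x₀ ξ U t ω).x)
    (hM : Measurable fun ω => vec (process F β τ η x₀ ξ U t ω).M) (hξ : Measurable (ξ t))
    (hu : Measurable fun ω => flatMask fun ℓ => U (t / τ) ℓ ω) :
    Measurable (fun ω => (process F β τ η x₀ ξ U (t + 1) ω).x) ∧
    Measurable fun ω => vec (process F β τ η x₀ ξ U (t + 1) ω).M := by
  have hM_succ : Measurable fun ω => vec (process F β τ η x₀ ξ U (t + 1) ω).M := by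
    simp only [vec_process_M_succ]
    exact measurable_maskMul.comp (hu.prodMk
      ((hM.const_smul (1 - β)).add ((hγ.comp (hx.prodMk hξ)).const_smul β)))
  refine ⟨?_, hM_succ⟩
  simp only [process_x_succ]
  exact hx.sub ((measurable_maskMul.comp (hu.prodMk hM_succ)).const_smul η)

lemma measurable_process (hγ : Measurable fun p : Params m n × Ξ => gradient (fun y => F y p.2) p.1)
    (β : ℝ) (τ : ℕ) (η : ℝ) (x₀ : Params m n) (t : ℕ) :
    Measurable[drawsAlgebra ξ U (pastDraws N t {j | j * τ < t})]
      (fun ω => (process F β τ η x₀ ξ U t ω).x) ∧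
    Measurable[drawsAlgebra ξ U (pastDraws N t {j | j * τ < t})]
      (fun ω => vec (process F β τ η x₀ ξ U t ω).M) := by
  induction t with
  | zero => exact ⟨measurable_const (a := x₀), measurable_const (a := vec fun _ => 0)⟩
  | succ t ih =>
    have hle : drawsAlgebra ξ U (pastDraws N t {j | j * τ < t})
        ≤ drawsAlgebra ξ U (pastDraws N (t + 1) {j | j * τ < t + 1}) :=
      drawsAlgebra_mono (pastDraws_mono t.le_succ fun _ => Nat.lt_succ_of_lt)
    exact measurable_process_succ hγ (ih.1.mono hle le_rfl) (ih.2.mono hle le_rfl)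
      (measurable_data_drawsAlgebra t.lt_succ_self)
      (measurable_mask_drawsAlgebra fun ℓ => Nat.lt_succ_of_le (Nat.div_mul_le_self t τ))

namespace IsSampling

variable [MeasurableSpace Ω] {D : Measure Ξ} {μ : Measure Ω} (hs : IsSampling D k μ ξ U)
include hs

lemma drawAlgebra_le (i : ℕ ⊕ (ℕ × Fin N)) : drawAlgebra ξ U i ≤ ‹MeasurableSpace Ω› := by
  rcases i with t | p
  · exact (hs.measurable_data t).comap_le
  · exact (hs.measurable_mask p.1 p.2).comap_le

lemma drawsAlgebra_le (A : Set (ℕ ⊕ (ℕ × Fin N))) : drawsAlgebra ξ U A ≤ ‹MeasurableSpace Ω› :=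
  iSup₂_le fun i _ => hs.drawAlgebra_le i

lemma measurable_flatMask (j : ℕ) : Measurable fun ω => flatMask fun ℓ => U j ℓ ω :=
  measurable_pi_lambda _ fun p => (measurable_entry p.2.1 p.2.2).comp (hs.measurable_mask j p.1)

lemma indepFun_of_disjoint {A B : Set (ℕ ⊕ (ℕ × Fin N))} (h : Disjoint A B) {α α' : Type*}
    [MeasurableSpace α] [MeasurableSpace α'] {f : Ω → α} {f' : Ω → α'}
    (hf : Measurable[drawsAlgebra ξ U A] f) (hf' : Measurable[drawsAlgebra ξ U B] f') :
    IndepFun f f' μ :=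
  (IndepFun_iff_Indep f f' μ).2 <| indep_of_indep_of_le_left
    (indep_of_indep_of_le_right (indep_iSup_of_disjoint hs.drawAlgebra_le hs.indep h)
      hf'.comap_le) hf.comap_le

lemma indepFun_process_data
    (hγ : Measurable fun p : Params m n × Ξ => gradient (fun y => F y p.2) p.1)
    (β : ℝ) (τ : ℕ) (η : ℝ) (x₀ : Params m n) (t : ℕ) :
    IndepFun (fun ω => ((process F β τ η x₀ ξ U t ω).x, vec (process F β τ η x₀ ξ U t ω).M,
      flatMask fun ℓ => U (t / τ) ℓ ω)) (ξ t) μ := by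
  have hle : drawsAlgebra ξ U (pastDraws N t {j | j * τ < t})
      ≤ drawsAlgebra ξ U (pastDraws N t {j | j * τ ≤ t}) :=
    drawsAlgebra_mono (pastDraws_mono le_rfl fun _ => Nat.le_of_lt)
  obtain ⟨hx, hM⟩ := measurable_process (ξ := ξ) (U := U) hγ β τ η x₀ t
  refine hs.indepFun_of_disjoint (A := pastDraws N t {j | j * τ ≤ t}) (B := {Sum.inl t})
    (Set.disjoint_singleton_right.2 fun hi => lt_irrefl t hi)
    ((hx.mono hle le_rfl).prodMk ((hM.mono hle le_rfl).prodMk ?_))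
    (measurable_data_drawsAlgebra (Set.mem_singleton _))
  exact measurable_mask_drawsAlgebra fun _ => Nat.div_mul_le_self t τ

lemma indepFun_process_mask
    (hγ : Measurable fun p : Params m n × Ξ => gradient (fun y => F y p.2) p.1)
    (β : ℝ) (τ : ℕ) (η : ℝ) (x₀ : Params m n) (j : ℕ)
    (p : (ℓ : Fin N) × (Fin (m ℓ) × Fin (n ℓ))) :
    IndepFun (fun ω => (process F β τ η x₀ ξ U (j * τ) ω).x)
      (fun ω => flatMask (fun ℓ => U j ℓ ω) p) μ := by
  have hx := (measurable_process (ξ := ξ) (U := U) hγ β τ η x₀ (j * τ)).1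
  have hu : Measurable[drawsAlgebra ξ U (Set.range fun ℓ => Sum.inr (j, ℓ))]
      fun ω => flatMask fun ℓ => U j ℓ ω :=
    measurable_mask_drawsAlgebra Set.mem_range_self
  refine hs.indepFun_of_disjoint ?_ hx ((measurable_pi_apply p).comp hu)
  rw [Set.disjoint_right]
  rintro _ ⟨ℓ, rfl⟩ hpast
  exact lt_irrefl (j * τ) hpast

lemma ae_isMask (j : ℕ) : ∀ᵐ ω ∂μ, IsMask (flatMask fun ℓ => U j ℓ ω) := by
  have hsparse (ℓ : Fin N) : ∀ᵐ ω ∂μ, U j ℓ ω ∈ sparseMasks (m ℓ) (n ℓ) (k ℓ) := by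
    refine ae_of_ae_map (hs.measurable_mask j ℓ).aemeasurable ?_
    rw [hs.law_mask]
    exact ae_mem_sparseMasks
  filter_upwards [ae_all_iff.2 hsparse] with ω hω p using (hω p.1).1 p.2.1 p.2.2

variable [IsProbabilityMeasure μ]

lemma integral_flatMask (j : ℕ) (p : (ℓ : Fin N) × (Fin (m ℓ) × Fin (n ℓ))) :
    ∫ ω, flatMask (fun ℓ => U j ℓ ω) p ∂μ = (k p.1 : ℝ) / ((m p.1 : ℝ) * (n p.1 : ℝ)) := by
  have hU := (hs.measurable_mask j p.1).aemeasurable (μ := μ)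
  have : IsProbabilityMeasure (uniformOn (sparseMasks (m p.1) (n p.1) (k p.1))) :=
    hs.law_mask j p.1 ▸ Measure.isProbabilityMeasure_map hU
  rw [← integral_entry_sparseMasks p.2.1 p.2.2, ← hs.law_mask j p.1,
    integral_map hU (measurable_entry p.2.1 p.2.2).aestronglyMeasurable]
  rfl

theorem isMaskedMSGD [IsProbabilityMeasure D] {σ : Fin N → ℝ} {L : ℝ} (hF : IsLoss F D)
    (hbdd : BddBelow (Set.range (objective F D))) (hL : LSmooth (objective F D) L)
    (hG : StochasticGradient F D σ) (β : ℝ) (τ : ℕ) (η : ℝ) (x₀ : Params m n) :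
    IsMaskedMSGD D μ (objective F D) (fun x s => gradient (fun y => F y s) x) L
      (totalNoise σ ^ 2) (minDensity m n k) β η τ x₀ ξ (fun j ω => flatMask fun ℓ => U j ℓ ω)
      (fun t ω => (process F β τ η x₀ ξ U t ω).x)
      (fun t ω => vec (process F β τ η x₀ ξ U t ω).M) where
  differentiable := hL.differentiable
  lipschitz := hL.lipschitz
  bddBelow := hbdd
  measurable_γ := hF.measurable_gradient
  noise := hG.isCenteredNoise
  measurable_ξ := hs.measurable_data
  measurable_u := hs.measurable_flatMask
  measurable_X t := (measurable_process hF.measurable_gradient β τ η x₀ t).1.mono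
    (hs.drawsAlgebra_le _) le_rfl
  measurable_M t := (measurable_process hF.measurable_gradient β τ η x₀ t).2.mono
    (hs.drawsAlgebra_le _) le_rfl
  law_ξ := hs.law_data
  isMask := hs.ae_isMask
  le_mask_mean j p := (minDensity_le k p.1).trans_eq (hs.integral_flatMask j p).symm
  X_zero _ := rfl
  M_zero _ := rfl
  M_succ := vec_process_M_succ F β τ η x₀ ξ U
  X_succ := process_x_succ F β τ η x₀ ξ U
  indep_ξ := hs.indepFun_process_data hF.measurable_gradient β τ η x₀
  indep_u := hs.indepFun_process_mask hF.measurable_gradient β τ η x₀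

end IsSampling

end Sampling

end GoSare

end

theorem mainTheorem8 :
    ∃ C : ℝ, 0 < C ∧
    ∀ (N : ℕ) (_ : 0 < N) (m n k : Fin N → ℕ)
      (_ : ∀ ℓ, 1 ≤ k ℓ) (_ : ∀ ℓ, k ℓ ≤ m ℓ * n ℓ)
      (Ξ : Type*) [MeasurableSpace Ξ] (D : MeasureTheory.Measure Ξ)
      [MeasureTheory.IsProbabilityMeasure D]
      (F : GoSare.Params m n → Ξ → ℝ) (_ : GoSare.IsLoss F D)
      (_ : BddBelow (Set.range (GoSare.objective F D)))
      (L : ℝ) (_ : 0 < L) (_ : GoSare.LSmooth (GoSare.objective F D) L)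
      (σ : Fin N → ℝ) (_ : GoSare.StochasticGradient F D σ)
      (x₀ : GoSare.Params m n)
      (Ω : Type*) [MeasurableSpace Ω] (μ : MeasureTheory.Measure Ω)
      [MeasureTheory.IsProbabilityMeasure μ]
      (ξ : ℕ → Ω → Ξ) (U : ℕ → (ℓ : Fin N) → Ω → Matrix (Fin (m ℓ)) (Fin (n ℓ)) ℝ)
      (_ : GoSare.IsSampling D k μ ξ U)
      (δ σtot Δ : ℝ) (_ : δ = GoSare.minDensity m n k) (_ : σtot = GoSare.totalNoise σ)
      (_ : Δ = GoSare.gap (GoSare.objective F D) x₀),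
      -- the bound for general hyperparameters
      (∀ (β : ℝ) (τ : ℕ) (η : ℝ), 0 < β → β ≤ 1 → 64 / (3 * β * δ) ≤ (τ : ℝ) →
        0 < η → η ≤ 1 / (4 * L) → η ≤ √(3 * δ * β ^ 2 / (80 * L ^ 2)) →
        η ≤ √(3 * δ / (80 * (τ : ℝ) ^ 2 * L ^ 2)) → η ≤ √(3 * β / (16 * (τ : ℝ) * L ^ 2)) →
        (∀ t, MeasureTheory.Integrable (GoSare.gradSq F D x₀ ξ U β τ η t) μ) ∧
        ∀ K : ℕ, 1 ≤ K →
          1 / ((K : ℝ) * (τ : ℝ)) * ∑ t ∈ Finset.range (K * τ), ∫ ω, GoSare.gradSq F D x₀ ξ U β τ η t ω ∂μ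
            ≤ 16 * Δ / (δ * η * (K : ℝ) * (τ : ℝ)) + 32 * β * σtot ^ 2 / (3 * δ)) ∧
      -- the rate for the tuned hyperparameters
      (0 < Δ → ∀ (T : ℕ), GoSare.minIterations δ σtot L Δ ≤ (T : ℝ) →
        ∀ (β : ℝ) (τ : ℕ) (η : ℝ), β = GoSare.tunedBeta δ σtot L Δ T →
        τ = GoSare.tunedTau δ σtot L Δ T → η = GoSare.tunedEta δ σtot L Δ T →
        (∀ t, MeasureTheory.Integrable (GoSare.gradSq F D x₀ ξ U β τ η t) μ) ∧
        1 / (T : ℝ) * ∑ t ∈ Finset.range T, ∫ ω, GoSare.gradSq F D x₀ ξ U β τ η t ω ∂μ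
          ≤ C * (L * Δ / (δ ^ (5 / 2 : ℝ) * T)
              + √(L * Δ * σtot ^ 2 / (δ ^ (7 / 2 : ℝ) * T)))) ∧
      -- the number of stochastic gradient evaluations that suffices for accuracy `ε`
      (0 < Δ → ∀ ε : ℝ, 0 < ε → ∃ T₀ : ℕ,
        (∀ ω, ((GoSare.process F (GoSare.tunedBeta δ σtot L Δ T₀)
            (GoSare.tunedTau δ σtot L Δ T₀) (GoSare.tunedEta δ σtot L Δ T₀)
            x₀ ξ U T₀ ω).calls : ℝ)
          ≤ C * (L * Δ * σtot ^ 2 / (δ ^ (7 / 2 : ℝ) * ε ^ 2) + L * Δ / (δ ^ (5 / 2 : ℝ) * ε)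
              + σtot ^ 2 / (δ ^ (1 / 2 : ℝ) * L * Δ) + 1 / δ)) ∧
        ∀ T : ℕ, T₀ ≤ T → GoSare.minIterations δ σtot L Δ ≤ (T : ℝ) ∧
          ∀ (β : ℝ) (τ : ℕ) (η : ℝ), β = GoSare.tunedBeta δ σtot L Δ T →
          τ = GoSare.tunedTau δ σtot L Δ T → η = GoSare.tunedEta δ σtot L Δ T →
          1 / (T : ℝ) * ∑ t ∈ Finset.range T, ∫ ω, GoSare.gradSq F D x₀ ξ U β τ η t ω ∂μ ≤ ε ∧
          ∃ t < T, ∫ ω, GoSare.gradSq F D x₀ ξ U β τ η t ω ∂μ ≤ ε) := by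
  refine ⟨3 * 10 ^ 7, by norm_num, ?_⟩
  rintro N hN m n k hk hkmn Ξ _ D _ F hF hbdd L hL hLs σ hG x₀ Ω _ μ _ ξ U hs _ _ _ rfl rfl rfl
  have hδ := GoSare.minDensity_pos hN hk hkmn
  have hδ1 := GoSare.minDensity_le_one hN hkmn
  have hsgd := fun β τ η => hs.isMaskedMSGD hF hbdd hLs hG β τ η x₀
  have htuned := fun hΔ T hT =>
    (hsgd _ _ _).average_tuned_integral_norm_sq_gradient_le (T := T) hδ hδ1 hL hΔ rfl hT
  refine ⟨fun β τ η hβ hβ1 hτ hη hηL hηβ hητ _ =>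
    ⟨(hsgd β τ η).integrable_norm_sq_gradient, fun K hK => ?_⟩, ?_, ?_⟩
  · exact (hsgd β τ η).average_integral_norm_sq_gradient_le hδ hδ1
      (.of_le_sqrt hδ hL hβ hβ1 hτ hη hηL hηβ hητ) hK
  · rintro hΔ T hT _ _ _ rfl rfl rfl
    exact ⟨(hsgd _ _ _).integrable_norm_sq_gradient, (htuned hΔ T hT).trans
      (mul_le_mul_of_nonneg_right (by norm_num) (GoSare.convergenceRate_nonneg hδ hL hΔ))⟩
  · refine fun hΔ ε hε => ⟨GoSare.sufficientIterations (GoSare.minDensity m n k)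
      (GoSare.totalNoise σ) L (GoSare.gap (GoSare.objective F D) x₀) ε,
      fun ω => ?_, fun T hT => ?_⟩
    · rw [GoSare.process_calls]
      exact GoSare.sufficientIterations_le hδ hδ1 hL hΔ hε
    · have hmin := GoSare.minIterations_le_of_sufficientIterations_le hδ hL hΔ hε hT
      refine ⟨hmin, ?_⟩
      rintro _ _ _ rfl rfl rfl
      have havg := (htuned hΔ T hmin).trans (GoSare.mul_convergenceRate_le hδ hL hΔ hε hT)
      exact ⟨havg, GoSare.exists_lt_le_of_average_le
        (GoSare.pos_of_minIterations_le hδ hL hΔ hmin) havg⟩
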